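/- Let $L>0$, $\kappa>0$, $\gamma\ge 0$ and $B\in\mathbb R$ satisfy $\kappa+\gamma B^3=\kappa B^4+\gamma B$ (equivalently, $B=\pm1$ or $B=\frac{\gamma\pm\sqrt{\gamma^2-4\kappa^2}}{2\kappa}$ when this is real) and $\kappa+\gamma B^3>0$. For $k\in(0,1)$ let $K(k)=\int_0^{\pi/2}\frac{dt}{\sqrt{1-k^2\sin^2 t}}$, let $\mathrm{sn}(\cdot,k),\mathrm{cn}(\cdot,k)$ be the Jacobi elliptic functions, and put $r=\sqrt{k^4-k^2+1}$, $$a=\frac2L\Big[(2-k^2+2r)L^2K(k)^2\Big]^{1/4},\qquad q=-1+k^2-r,\qquad \omega_L(k)=\frac{16K(k)^2\,r}{L^2}.$$ For every $\omega>\frac{4\pi^2}{L^2}$ there is exactly one $k\in(0,1)$ with $\omega_L(k)=\omega$; with this $k$, let $\varphi_\omega$ be the $L$-periodic cnoidal wave $$\varphi_\omega(x)=\frac{1}{(\kappa+\gamma B^3)^{1/4}}\;\frac{a\,\mathrm{cn}\big(\tfrac{4K(k)}{L}x,k\big)}{\sqrt{1-q\,\mathrm{sn}^2\big(\tfrac{4K(k)}{L}x,k\big)}},$$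 the wave profile associated with the equation $-\varphi''+\omega\varphi-(\kappa+\gamma B^3)\varphi^5=0$. Let $L^2_{\rm per}$ be the space of complex $L$-periodic functions with $(f,g)_{L^2}=\int_0^L f\bar g\,dx$, and let $\mathcal L_1=-\partial_x^2+\omega-\beta_1\varphi_\omega^4: H^2_{\rm per}\subset L^2_{\rm per}\to L^2_{\rm per}$ with $\beta_1=5(\kappa+\gamma B^3)$. Then, for every $\omega>\frac{4\pi^2}{L^2}$: 1. the map $w\mapsto\|\varphi_w\|_{L^2}^2$ is differentiable at $\omega$ and $\frac{d}{d\omega}\|\varphi_\omega\|_{L^2}^2>0$; 2. $(\mathcal L_1^{-1}\varphi_\omega,\varphi_\omega)_{L^2}<0$. That is: there is exactly one $u\in H^2_{\rm per}$ orthogonal to $\ker\mathcal L_1$ with $\mathcal L_1u=\varphi_\omega$, and every $u\in H^2_{\rm per}$ with $\mathcal L_1u=\varphi_\omega$ has $(u,\varphi_\omega)_{L^2}$ real and negative. -/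

import Mathlib

open Set MeasureTheory

namespace CnoidalWave

noncomputable section

/-! ### Elliptic integrals and Jacobi elliptic functions of modulus `k` -/

/-- The incomplete elliptic integral of the first kind `F(η, k)`. -/
def ellipticF (k η : ℝ) : ℝ :=
  ∫ t in (0 : ℝ)..η, 1 / √(1 - k ^ 2 * Real.sin t ^ 2)

/-- The complete elliptic integral of the first kind `K(k) = F(π/2, k)`. -/
def ellipticK (k : ℝ) : ℝ := ellipticF k (Real.pi / 2)

/-- The Jacobi amplitude `am(·, k)`, the inverse function of `F(·, k)`. -/
def amplitude (k : ℝ) : ℝ → ℝ := Function.invFun (ellipticF k)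

/-- The Jacobi elliptic function `sn(·, k)`. -/
def sn (x k : ℝ) : ℝ := Real.sin (amplitude k x)

/-- The Jacobi elliptic function `cn(·, k)`. -/
def cn (x k : ℝ) : ℝ := Real.cos (amplitude k x)

section elliptic

variable {k : ℝ}

theorem radicand_pos (hk : k ∈ Ioo (0 : ℝ) 1) (t : ℝ) : 0 < 1 - k ^ 2 * Real.sin t ^ 2 := by
  have h1 : Real.sin t ^ 2 ≤ 1 := Real.sin_sq_le_one t
  have h2 : k ^ 2 < 1 := by nlinarith [hk.1, hk.2]
  nlinarith [sq_nonneg k, sq_nonneg (Real.sin t)]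

theorem continuous_integrand (hk : k ∈ Ioo (0 : ℝ) 1) :
    Continuous fun t : ℝ => 1 / √(1 - k ^ 2 * Real.sin t ^ 2) := by
  refine continuous_const.div (by fun_prop) fun t => ?_
  exact (Real.sqrt_pos.2 (radicand_pos hk t)).ne'

theorem one_le_integrand (hk : k ∈ Ioo (0 : ℝ) 1) (t : ℝ) :
    1 ≤ 1 / √(1 - k ^ 2 * Real.sin t ^ 2) := by
  rw [le_div_iff₀ (Real.sqrt_pos.2 (radicand_pos hk t)), one_mul]
  refine Real.sqrt_le_one.2 ?_
  nlinarith [mul_nonneg (sq_nonneg k) (sq_nonneg (Real.sin t))]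

theorem ellipticF_sub (hk : k ∈ Ioo (0 : ℝ) 1) (x y : ℝ) :
    ellipticF k y - ellipticF k x = ∫ t in x..y, 1 / √(1 - k ^ 2 * Real.sin t ^ 2) :=
  intervalIntegral.integral_interval_sub_left
    ((continuous_integrand hk).intervalIntegrable _ _)
    ((continuous_integrand hk).intervalIntegrable _ _)

theorem sub_le_ellipticF_sub (hk : k ∈ Ioo (0 : ℝ) 1) {x y : ℝ} (h : x ≤ y) :
    y - x ≤ ellipticF k y - ellipticF k x := by
  rw [ellipticF_sub hk]
  have := intervalIntegral.integral_mono_on (μ := volume) h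
    (f := fun _ => (1 : ℝ)) (g := fun t => 1 / √(1 - k ^ 2 * Real.sin t ^ 2))
    (by simp) ((continuous_integrand hk).intervalIntegrable _ _)
    (fun t _ => one_le_integrand hk t)
  simpa using this

theorem ellipticF_zero : ellipticF k 0 = 0 := by simp [ellipticF]

theorem strictMono_ellipticF (hk : k ∈ Ioo (0 : ℝ) 1) : StrictMono (ellipticF k) := by
  intro x y h
  have := sub_le_ellipticF_sub hk h.le
  linarith

theorem continuous_ellipticF (hk : k ∈ Ioo (0 : ℝ) 1) : Continuous (ellipticF k) :=
  intervalIntegral.continuous_primitive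
    (fun _ _ => (continuous_integrand hk).intervalIntegrable _ _) 0

theorem surjective_ellipticF (hk : k ∈ Ioo (0 : ℝ) 1) : Function.Surjective (ellipticF k) := by
  refine (continuous_ellipticF hk).surjective ?_ ?_
  · refine Filter.tendsto_atTop_mono' _ ?_ Filter.tendsto_id
    filter_upwards [Filter.eventually_ge_atTop 0] with x hx
    have := sub_le_ellipticF_sub hk hx
    rw [ellipticF_zero] at this
    simpa using this
  · refine Filter.tendsto_atBot_mono' _ ?_ Filter.tendsto_id
    filter_upwards [Filter.eventually_le_atBot 0] with x hx
    have := sub_le_ellipticF_sub hk hx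
    rw [ellipticF_zero] at this
    simp only [id]
    linarith

theorem ellipticF_amplitude (hk : k ∈ Ioo (0 : ℝ) 1) (x : ℝ) :
    ellipticF k (amplitude k x) = x :=
  Function.rightInverse_invFun (surjective_ellipticF hk) x

theorem amplitude_ellipticF (hk : k ∈ Ioo (0 : ℝ) 1) (η : ℝ) :
    amplitude k (ellipticF k η) = η :=
  Function.leftInverse_invFun (strictMono_ellipticF hk).injective η

theorem continuous_amplitude (hk : k ∈ Ioo (0 : ℝ) 1) : Continuous (amplitude k) := by
  have h : amplitude k =
      ((strictMono_ellipticF hk).orderIsoOfSurjective _ (surjective_ellipticF hk)).symm := by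
    funext x
    apply (strictMono_ellipticF hk).injective
    rw [ellipticF_amplitude hk]
    exact (((strictMono_ellipticF hk).orderIsoOfSurjective _
      (surjective_ellipticF hk)).apply_symm_apply x).symm
  rw [h]
  exact OrderIso.continuous _

theorem periodic_integrand (k : ℝ) :
    Function.Periodic (fun t : ℝ => 1 / √(1 - k ^ 2 * Real.sin t ^ 2)) Real.pi := by
  intro t
  simp [Real.sin_add_pi]

theorem ellipticF_pi (hk : k ∈ Ioo (0 : ℝ) 1) : ellipticF k Real.pi = 2 * ellipticK k := by
  have h1 := ellipticF_sub hk (Real.pi / 2) Real.pi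
  have h2 : ∫ t in (Real.pi / 2)..Real.pi, 1 / √(1 - k ^ 2 * Real.sin t ^ 2)
      = ellipticK k := by
    have := intervalIntegral.integral_comp_sub_left (a := 0) (b := Real.pi / 2)
      (fun t : ℝ => 1 / √(1 - k ^ 2 * Real.sin t ^ 2)) Real.pi
    simp only [Real.sin_pi_sub, sub_zero] at this
    rw [ellipticK, ellipticF, this]
    congr 1
    ring
  rw [h2] at h1
  unfold ellipticK at *
  linarith

theorem ellipticF_add_pi (hk : k ∈ Ioo (0 : ℝ) 1) (η : ℝ) :
    ellipticF k (η + Real.pi) = ellipticF k η + 2 * ellipticK k := by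
  have h1 := ellipticF_sub hk η (η + Real.pi)
  rw [(periodic_integrand k).intervalIntegral_add_eq η 0, zero_add] at h1
  rw [← ellipticF_pi hk]
  unfold ellipticF at *
  linarith

theorem amplitude_add_four_mul (hk : k ∈ Ioo (0 : ℝ) 1) (x : ℝ) :
    amplitude k (x + 4 * ellipticK k) = amplitude k x + 2 * Real.pi := by
  apply (strictMono_ellipticF hk).injective
  rw [ellipticF_amplitude hk,
    show amplitude k x + 2 * Real.pi = (amplitude k x + Real.pi) + Real.pi by ring,
    ellipticF_add_pi hk, ellipticF_add_pi hk, ellipticF_amplitude hk]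
  ring

theorem continuous_sn (hk : k ∈ Ioo (0 : ℝ) 1) : Continuous fun x => sn x k :=
  Real.continuous_sin.comp (continuous_amplitude hk)

theorem continuous_cn (hk : k ∈ Ioo (0 : ℝ) 1) : Continuous fun x => cn x k :=
  Real.continuous_cos.comp (continuous_amplitude hk)

theorem sn_add_four_mul (hk : k ∈ Ioo (0 : ℝ) 1) (x : ℝ) :
    sn (x + 4 * ellipticK k) k = sn x k := by
  simp [sn, amplitude_add_four_mul hk]

theorem cn_add_four_mul (hk : k ∈ Ioo (0 : ℝ) 1) (x : ℝ) :
    cn (x + 4 * ellipticK k) k = cn x k := by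
  simp [cn, amplitude_add_four_mul hk]

end elliptic

/-! ### The cnoidal waves -/

/-- `√(k⁴ - k² + 1)`. -/
def rootR (k : ℝ) : ℝ := √(k ^ 4 - k ^ 2 + 1)

/-- The amplitude parameter `a` of the wave. -/
def paramA (L k : ℝ) : ℝ :=
  2 / L * ((2 - k ^ 2 + 2 * rootR k) * L ^ 2 * ellipticK k ^ 2) ^ (1 / 4 : ℝ)

/-- The parameter `q` of the wave. -/
def paramQ (k : ℝ) : ℝ := -1 + k ^ 2 - rootR k

/-- The frequency `ω` of the wave of modulus `k` and period `L`. -/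
def frequency (L k : ℝ) : ℝ := 16 * ellipticK k ^ 2 * rootR k / L ^ 2

/-- The cnoidal profile of modulus `k` and period `L`,
for the equation `-φ'' + ω φ - (κ + γ B³) φ⁵ = 0`. -/
def profile (κ γ B L k x : ℝ) : ℝ :=
  1 / (κ + γ * B ^ 3) ^ (1 / 4 : ℝ) *
    (paramA L k * cn (4 * ellipticK k / L * x) k /
      √(1 - paramQ k * sn (4 * ellipticK k / L * x) k ^ 2))

theorem paramQ_nonpos (k : ℝ) : paramQ k ≤ 0 := by
  have : k ^ 2 - 1 ≤ rootR k := Real.le_sqrt_of_sq_le (by nlinarith [sq_nonneg k])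
  unfold paramQ
  linarith

theorem continuous_profile (κ γ B L : ℝ) {k : ℝ} (hk : k ∈ Ioo (0 : ℝ) 1) :
    Continuous (profile κ γ B L k) := by
  unfold profile
  have h1 : Continuous fun x : ℝ => cn (4 * ellipticK k / L * x) k :=
    (continuous_cn hk).comp (continuous_const.mul continuous_id)
  have h2 : Continuous fun x : ℝ => sn (4 * ellipticK k / L * x) k :=
    (continuous_sn hk).comp (continuous_const.mul continuous_id)
  refine continuous_const.mul ((continuous_const.mul h1).div
    (Real.continuous_sqrt.comp (continuous_const.sub (continuous_const.mul (h2.pow 2))))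
    fun x => ?_)
  refine (Real.sqrt_pos.2 ?_).ne'
  nlinarith [mul_nonneg (neg_nonneg.2 (paramQ_nonpos k))
    (sq_nonneg (sn (4 * ellipticK k / L * x) k))]

theorem periodic_profile (κ γ B : ℝ) {L : ℝ} (hL : 0 < L) {k : ℝ} (hk : k ∈ Ioo (0 : ℝ) 1) :
    Function.Periodic (profile κ γ B L k) L := by
  intro x
  have h : 4 * ellipticK k / L * (x + L) = 4 * ellipticK k / L * x + 4 * ellipticK k := by
    field_simp
  simp only [profile, h, sn_add_four_mul hk, cn_add_four_mul hk]

instance nonempty_modulus : Nonempty (Ioo (0 : ℝ) 1) := ⟨⟨1 / 2, by norm_num, by norm_num⟩⟩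

/-- The modulus `k ∈ (0, 1)` with `frequency L k = ω` (when there is exactly one). -/
def modulus (L ω : ℝ) : Ioo (0 : ℝ) 1 :=
  Function.invFun (fun k : Ioo (0 : ℝ) 1 => frequency L k) ω

variable (L : ℝ) [hL : Fact (0 < L)]

/-- The cnoidal wave `φ_ω`, as a continuous function on the circle `ℝ / Lℤ`. -/
def wave (κ γ B ω : ℝ) : C(AddCircle L, ℝ) where
  toFun := (periodic_profile κ γ B hL.out (modulus L ω).2).lift
  continuous_toFun :=
    continuous_coinduced_dom.2 (continuous_profile κ γ B L (modulus L ω).2)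

/-- The space `L²_per` of complex-valued functions, with inner product the integral over one
period (the measure on the circle has total mass `L`). -/
abbrev L2per : Type := Lp ℂ 2 (volume : Measure (AddCircle L))

/-- A real continuous function on the circle, seen as a complex one. -/
def toComplex (f : C(AddCircle L, ℝ)) : C(AddCircle L, ℂ) :=
  ⟨fun x => (f x : ℂ), Complex.continuous_ofReal.comp f.continuous⟩

/-- The cnoidal wave `φ_ω` as an element of `L²_per`. -/
def waveL2 (κ γ B ω : ℝ) : L2per L :=
  ContinuousMap.toLp 2 volume ℂ (toComplex L (wave L κ γ B ω))

/-! ### Hill operators on `L²_per` -/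

theorem ae_haar_of_ae {p : AddCircle L → Prop} (h : ∀ᵐ x ∂(volume : Measure (AddCircle L)), p x) :
    ∀ᵐ x ∂(AddCircle.haarAddCircle (T := L)), p x := by
  rw [AddCircle.volume_eq_smul_haarAddCircle] at h
  exact (Measure.ae_ennreal_smul_measure_iff
    (by simpa using hL.out)).1 h

theorem ae_of_ae_haar {p : AddCircle L → Prop}
    (h : ∀ᵐ x ∂(AddCircle.haarAddCircle (T := L)), p x) :
    ∀ᵐ x ∂(volume : Measure (AddCircle L)), p x := by
  rw [AddCircle.volume_eq_smul_haarAddCircle]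
  exact Measure.ae_smul_measure h _

theorem memLp_haar (u : L2per L) : MemLp u 2 (AddCircle.haarAddCircle (T := L)) :=
  memLp_haarAddCircle_iff.2 (Lp.memLp u)

theorem fourierCoeff_add (u v : L2per L) (n : ℤ) :
    fourierCoeff (u + v : L2per L) n = fourierCoeff u n + fourierCoeff v n := by
  rw [fourierCoeff_congr_ae (ae_haar_of_ae L (Lp.coeFn_add u v)),
    fourierCoeff.add ((memLp_haar L u).integrable (by norm_num))
      ((memLp_haar L v).integrable (by norm_num))]
  rfl

theorem fourierCoeff_smul (c : ℂ) (u : L2per L) (n : ℤ) :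
    fourierCoeff (c • u : L2per L) n = c * fourierCoeff u n := by
  rw [fourierCoeff_congr_ae (ae_haar_of_ae L (Lp.coeFn_smul c u)), fourierCoeff.const_smul]
  rfl

theorem fourierCoeff_zero (n : ℤ) : fourierCoeff (0 : L2per L) n = 0 := by
  simpa using fourierCoeff_smul L 0 0 n

theorem eq_of_fourierCoeff_eq {u v : L2per L} (h : ∀ n, fourierCoeff u n = fourierCoeff v n) :
    u = v := by
  have h1 : (memLp_haar L u).toLp u = (memLp_haar L v).toLp v := by
    apply fourierBasis.repr.injective
    ext n
    rw [fourierBasis_repr, fourierBasis_repr,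
      fourierCoeff_congr_ae (memLp_haar L u).coeFn_toLp,
      fourierCoeff_congr_ae (memLp_haar L v).coeFn_toLp, h]
  have h2 := (MemLp.toLp_eq_toLp_iff _ _).1 h1
  apply Lp.ext
  exact ae_of_ae_haar L h2

theorem exists_fourierCoeff_eq {c : ℤ → ℂ} (hc : Summable fun n => ‖c n‖ ^ 2) :
    ∃ g : L2per L, ∀ n, fourierCoeff g n = c n := by
  have hc' : Memℓp c 2 := by
    refine memℓp_gen ?_
    simpa using hc
  set w := (fourierBasis (T := L)).repr.symm ⟨c, hc'⟩ with hw
  have hm : MemLp w 2 (volume : Measure (AddCircle L)) := memLp_haarAddCircle_iff.1 (Lp.memLp w)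
  refine ⟨hm.toLp w, fun n => ?_⟩
  rw [fourierCoeff_congr_ae (ae_haar_of_ae L hm.coeFn_toLp), ← fourierBasis_repr, hw,
    LinearIsometryEquiv.apply_symm_apply]

/-- The Sobolev space `H²_per`, as a subspace of `L²_per`. -/
def H2per : Submodule ℂ (L2per L) where
  carrier := {u | Summable fun n : ℤ => (1 + (n : ℝ) ^ 2) ^ 2 * ‖fourierCoeff u n‖ ^ 2}
  zero_mem' := by
    refine summable_zero.congr fun n => ?_
    rw [fourierCoeff_zero]
    simp
  add_mem' := by
    intro u v hu hv
    refine Summable.of_nonneg_of_le (fun n => by positivity) (fun n => ?_)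
      ((hu.add hv).mul_left 2)
    rw [fourierCoeff_add]
    have h1 := norm_add_le (fourierCoeff u n) (fourierCoeff v n)
    have h2 : ‖fourierCoeff u n + fourierCoeff v n‖ ^ 2
        ≤ 2 * (‖fourierCoeff u n‖ ^ 2 + ‖fourierCoeff v n‖ ^ 2) := by
      nlinarith [norm_nonneg (fourierCoeff u n + fourierCoeff v n),
        sq_nonneg (‖fourierCoeff u n‖ - ‖fourierCoeff v n‖)]
    calc _ ≤ (1 + (n : ℝ) ^ 2) ^ 2 *
          (2 * (‖fourierCoeff u n‖ ^ 2 + ‖fourierCoeff v n‖ ^ 2)) := by gcongr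
      _ = _ := by ring
  smul_mem' := by
    intro c u hu
    refine (hu.mul_left (‖c‖ ^ 2)).congr fun n => ?_
    rw [fourierCoeff_smul, norm_mul]
    ring

theorem exists_negSecondDeriv (u : H2per L) :
    ∃ g : L2per L, ∀ n : ℤ,
      fourierCoeff g n = (((2 * Real.pi * n / L) ^ 2 : ℝ) : ℂ) * fourierCoeff (u : L2per L) n := by
  refine exists_fourierCoeff_eq L (Summable.of_nonneg_of_le (fun n => by positivity)
    (fun n => ?_) (u.2.mul_left ((2 * Real.pi / L) ^ 4)))
  rw [norm_mul, Complex.norm_real, Real.norm_eq_abs, mul_pow, sq_abs]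
  have h : ((n : ℝ) ^ 2) ^ 2 ≤ (1 + (n : ℝ) ^ 2) ^ 2 := by gcongr; linarith
  calc _ = (2 * Real.pi / L) ^ 4 * (((n : ℝ) ^ 2) ^ 2 *
        ‖fourierCoeff (u : L2per L) n‖ ^ 2) := by ring
    _ ≤ _ := by gcongr

/-- The operator `-∂ₓ² : H²_per → L²_per`, i.e. the Fourier multiplier `(2πn/L)²`. -/
def negSecondDeriv : H2per L →ₗ[ℂ] L2per L where
  toFun u := (exists_negSecondDeriv L u).choose
  map_add' u v := by
    refine eq_of_fourierCoeff_eq L fun n => ?_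
    rw [fourierCoeff_add, (exists_negSecondDeriv L (u + v)).choose_spec,
      (exists_negSecondDeriv L u).choose_spec, (exists_negSecondDeriv L v).choose_spec,
      Submodule.coe_add, fourierCoeff_add]
    ring
  map_smul' c u := by
    refine eq_of_fourierCoeff_eq L fun n => ?_
    rw [RingHom.id_apply, fourierCoeff_smul, (exists_negSecondDeriv L (c • u)).choose_spec,
      (exists_negSecondDeriv L u).choose_spec, Submodule.coe_smul, fourierCoeff_smul]
    ring

theorem fourierCoeff_negSecondDeriv (u : H2per L) (n : ℤ) :
    fourierCoeff (negSecondDeriv L u) n =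
      (((2 * Real.pi * n / L) ^ 2 : ℝ) : ℂ) * fourierCoeff (u : L2per L) n :=
  (exists_negSecondDeriv L u).choose_spec n

/-- Multiplication by a real continuous function on `L²_per`. -/
def mulOperator (V : C(AddCircle L, ℝ)) : L2per L →ₗ[ℂ] L2per L :=
  (ContinuousLinearMap.holderL volume ⊤ 2 2 (ContinuousLinearMap.mul ℂ ℂ)
    (ContinuousMap.toLp ⊤ volume ℂ (toComplex L V))).toLinearMap

theorem coeFn_mulOperator (V : C(AddCircle L, ℝ)) (u : L2per L) :
    mulOperator L V u =ᵐ[volume] fun x => (V x : ℂ) * u x := by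
  have h1 := ContinuousLinearMap.coeFn_holder (ContinuousLinearMap.mul ℂ ℂ) (r := 2)
    (ContinuousMap.toLp ⊤ volume ℂ (toComplex L V) : Lp ℂ ⊤ (volume : Measure (AddCircle L))) u
  have h2 := ContinuousMap.coeFn_toLp (p := ⊤) (𝕜 := ℂ)
    (volume : Measure (AddCircle L)) (toComplex L V)
  filter_upwards [h1, h2] with x hx1 hx2
  refine hx1.trans ?_
  rw [hx2]
  rfl

/-- The Hill operator `-∂ₓ² + V : H²_per ⊂ L²_per → L²_per`. -/
def hillOperator (V : C(AddCircle L, ℝ)) : L2per L →ₗ.[ℂ] L2per L where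
  domain := H2per L
  toFun := negSecondDeriv L + (mulOperator L V).comp (H2per L).subtype

/-- The constant `4 × 4` matrix `S` of the linearized operator
`(-∂ₓ² + ω) Id - φ⁴ S` around the standing wave `(φ, B φ, 0, 0)`. -/
def matrixS (κ γ B : ℝ) : Matrix (Fin 4) (Fin 4) ℝ :=
  !![5 * κ + 2 * γ * B ^ 3, 3 * γ * B ^ 2, 0, 0;
     3 * γ * B ^ 2, 5 * κ * B ^ 4 + 2 * γ * B, 0, 0;
     0, 0, κ - 2 * γ * B ^ 3, 3 * γ * B ^ 2;
     0, 0, 3 * γ * B ^ 2, κ * B ^ 4 - 2 * γ * B]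

/-- The eigenvalue `β₁` of `S`. -/
def beta1 (κ γ B : ℝ) : ℝ := 5 * (κ + γ * B ^ 3)

theorem matrixS_mulVec (κ γ B : ℝ) (hB : κ + γ * B ^ 3 = κ * B ^ 4 + γ * B) :
    (matrixS κ γ B).mulVec ![1, B, 0, 0] = beta1 κ γ B • ![1, B, 0, 0] := by
  have h : 3 * γ * B ^ 2 + (5 * κ * B ^ 4 + 2 * γ * B) * B = 5 * (κ + γ * B ^ 3) * B := by
    linear_combination (-5 * B) * hB
  ext i
  fin_cases i
  · simp [matrixS, beta1, Matrix.mulVec, dotProduct, Fin.sum_univ_four]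
    ring
  · simpa [matrixS, beta1, Matrix.mulVec, dotProduct, Fin.sum_univ_four] using h
  · simp [matrixS, Matrix.mulVec, dotProduct, Fin.sum_univ_four]
  · simp [matrixS, Matrix.mulVec, dotProduct, Fin.sum_univ_four]

/-- The Hill operator `ℒ₁ = -∂ₓ² + ω - β₁ φ_ω⁴ : H²_per ⊂ L²_per → L²_per`. -/
def operatorL1 (κ γ B ω : ℝ) : L2per L →ₗ.[ℂ] L2per L :=
  hillOperator L (ContinuousMap.const _ ω - beta1 κ γ B • wave L κ γ B ω ^ 4)

end

end CnoidalWave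

/-!
The first integral of the profile equation is a cubic in `s = φ² / max φ²` with roots of sum zero,
one of which is `s = 1`; the remaining factor is `s² + s + d` for a single parameter `d`. With the
angle `τ` defined by `φ = max φ · cos τ` the wave equation becomes
`dx/dτ = const / √(cos⁴ τ + cos² τ + d)`. With `P(d) = ∫ dτ / √(cos⁴ τ + cos² τ + d)` over a quarter
period, the frequency is `16 (1 - d) P(d)² / L²`, and the mass is a constant times
`∫ cos² τ / √(cos⁴ τ + cos² τ + d) dτ`. Both decrease in `d` because their integrands do
(`freqDeriv_neg`, `exists_hasDerivAt_massIntegral_neg`), so the mass increases with the frequency.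
To have a parameter which is free to run over the real line, `d` is written `exp σ`.

The Jacobi form of the wave corresponds to `d = e (1 - e)`, where `-e` and `e - 1` are the roots of
`s² + s + d`. In terms of `e ∈ (1/2, 1)` one has `k² = (2 e - 1) / (e (2 - e))`, and the
substitution `tan τ = √((1 + e) / e) tan θ` transforms the two elliptic integrals into one another
(`angleTime_tanScale`, `profile_eq_angularWave`, `frequency_eq_freq`). The frequencies
`ω > 4 π² / L²` are those with `0 < d < 1/4`: at `d = 1/4` the integrand is elementary
(`quarterPeriod_log_quarter`), and as `d → 0` the period integral diverges
(`neg_div_four_le_quarterPeriod`).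

By the implicit function theorem (`hasStrictFDerivAt_angle`) the wave is `C¹` in `σ`.
Differentiating the profile equation, tested against exponentials, shows that `u = -∂φ / ω'`
satisfies the equation `ℒ₁ u = φ` on the level of Fourier coefficients
(`linearizedSolution_weak`), whence `u` lies in `H²_per` (`mem_domain_of_weak`) and
`(u, φ) = -(‖φ‖²)' / (2 ω') < 0` (`inner_linearizedSolution`), a prime denoting `d/dσ`. As `ℒ₁` is
symmetric, every other solution has the same pairing with `φ` (`inner_solution_eq`). The kernel of
`ℒ₁` is closed in `L²_per`, being cut out by continuous conditions on Fourier coefficients, and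
subtracting the orthogonal projection onto it gives the solution orthogonal to the kernel
(`existsUnique_orthogonal_solution`).
-/

namespace CnoidalWave

noncomputable section

open Filter Topology

/-! ### The period integral in the angular variable -/

/-- Differentiation under an interval integral whose integrand is jointly `C¹` in the parameter. -/
theorem hasDerivAt_intervalIntegral_of_continuous {E : Type*} [NormedAddCommGroup E]
    [NormedSpace ℝ E] {F F' : ℝ → ℝ → E} (hF : Continuous F.uncurry)
    (hF' : Continuous F'.uncurry) (h : ∀ s t, HasDerivAt (fun s => F s t) (F' s t) s)
    (a b s : ℝ) :
    HasDerivAt (fun s => ∫ t in a..b, F s t) (∫ t in a..b, F' s t) s := by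
  have hc : ∀ s, Continuous (F s) := fun s => hF.uncurry_left s
  have hc' : ∀ s, Continuous (F' s) := fun s => hF'.uncurry_left s
  obtain ⟨C, hC⟩ := ((isCompact_closedBall s 1).prod
    (isCompact_uIcc (a := a) (b := b))).exists_bound_of_continuousOn hF'.continuousOn
  refine (intervalIntegral.hasDerivAt_integral_of_dominated_loc_of_deriv_le
    (bound := fun _ => C) (Metric.closedBall_mem_nhds s one_pos)
    (Eventually.of_forall fun s => (hc s).aestronglyMeasurable)
    ((hc s).intervalIntegrable _ _) (hc' s).aestronglyMeasurable
    (Eventually.of_forall fun t ht r hr => ?_) (by simp)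
    (Eventually.of_forall fun t _ r _ => h r t)).2
  exact hC (r, t) ⟨hr, uIoc_subset_uIcc ht⟩

/-- With `s = cos² t`, this is the quadratic factor `s² + s + d` which remains of the cubic in the
first integral of the wave equation once the root `s = 1` is split off; the parameter
`d = exp σ` is positive for all real `σ`. -/
def quartic (σ t : ℝ) : ℝ := Real.cos t ^ 4 + Real.cos t ^ 2 + Real.exp σ

theorem exp_le_quartic (σ t : ℝ) : Real.exp σ ≤ quartic σ t := by
  unfold quartic
  have : 0 ≤ Real.cos t ^ 4 + Real.cos t ^ 2 := by positivity
  linarith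

theorem quartic_pos (σ t : ℝ) : 0 < quartic σ t := (Real.exp_pos σ).trans_le (exp_le_quartic σ t)

theorem continuous_quartic : Continuous quartic.uncurry := by
  unfold quartic Function.uncurry
  fun_prop

theorem sqrt_quartic_pos (σ t : ℝ) : 0 < √(quartic σ t) := Real.sqrt_pos.2 (quartic_pos σ t)

/-- The density of the space variable with respect to the angle `t`, up to a constant. -/
def density (σ t : ℝ) : ℝ := 1 / √(quartic σ t)

/-- The `σ`-derivative of `density`. -/
def densityDeriv (σ t : ℝ) : ℝ := -(Real.exp σ / (2 * quartic σ t * √(quartic σ t)))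

theorem density_pos (σ t : ℝ) : 0 < density σ t := one_div_pos.2 (sqrt_quartic_pos σ t)

theorem densityDeriv_neg (σ t : ℝ) : densityDeriv σ t < 0 := by
  have := quartic_pos σ t
  have := sqrt_quartic_pos σ t
  unfold densityDeriv
  have := Real.exp_pos σ
  have : 0 < Real.exp σ / (2 * quartic σ t * √(quartic σ t)) := by positivity
  linarith

theorem continuous_density : Continuous density.uncurry :=
  continuous_const.div continuous_quartic.sqrt fun p => (sqrt_quartic_pos p.1 p.2).ne'

theorem continuous_densityDeriv : Continuous densityDeriv.uncurry := by
  refine Continuous.neg (Continuous.div (Real.continuous_exp.comp continuous_fst)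
    ((continuous_const.mul continuous_quartic).mul continuous_quartic.sqrt) fun p => ?_)
  exact (mul_pos (mul_pos two_pos (quartic_pos p.1 p.2)) (sqrt_quartic_pos p.1 p.2)).ne'

theorem hasDerivAt_density (σ t : ℝ) :
    HasDerivAt (fun σ => density σ t) (densityDeriv σ t) σ := by
  have hq : HasDerivAt (fun σ => quartic σ t) (Real.exp σ) σ :=
    (Real.hasDerivAt_exp σ).const_add _
  have h := (hq.sqrt (quartic_pos σ t).ne').fun_inv (sqrt_quartic_pos σ t).ne'
  have h2 : Real.sqrt (quartic σ t) ^ 2 = quartic σ t := Real.sq_sqrt (quartic_pos σ t).le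
  have := sqrt_quartic_pos σ t
  have := quartic_pos σ t
  simp only [density, one_div]
  convert! h using 1
  rw [densityDeriv, h2]
  field_simp

/-- The rescaled space variable as a function of the angle. -/
def angleTime (σ τ : ℝ) : ℝ := ∫ t in (0 : ℝ)..τ, density σ t

/-- The `σ`-derivative of `angleTime`. -/
def angleTimeDeriv (σ τ : ℝ) : ℝ := ∫ t in (0 : ℝ)..τ, densityDeriv σ t

/-- A quarter of the rescaled period. -/
def quarterPeriod (σ : ℝ) : ℝ := angleTime σ (Real.pi / 2)

/-- The derivative of `quarterPeriod`. -/
def quarterPeriodDeriv (σ : ℝ) : ℝ := angleTimeDeriv σ (Real.pi / 2)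

theorem continuous_density_right (σ : ℝ) : Continuous (density σ) :=
  continuous_density.uncurry_left σ

theorem continuous_densityDeriv_right (σ : ℝ) : Continuous (densityDeriv σ) :=
  continuous_densityDeriv.uncurry_left σ

theorem continuous_angleTime : Continuous angleTime.uncurry :=
  intervalIntegral.continuous_parametric_primitive_of_continuous continuous_density

theorem continuous_angleTimeDeriv : Continuous angleTimeDeriv.uncurry :=
  intervalIntegral.continuous_parametric_primitive_of_continuous continuous_densityDeriv

theorem hasDerivAt_angleTime_left (σ τ : ℝ) :
    HasDerivAt (fun σ => angleTime σ τ) (angleTimeDeriv σ τ) σ :=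
  hasDerivAt_intervalIntegral_of_continuous continuous_density continuous_densityDeriv
    hasDerivAt_density 0 τ σ

theorem hasDerivAt_angleTime_right (σ τ : ℝ) :
    HasDerivAt (angleTime σ) (density σ τ) τ :=
  ((continuous_density_right σ).integral_hasStrictDerivAt 0 τ).hasDerivAt

theorem hasDerivAt_quarterPeriod (σ : ℝ) :
    HasDerivAt quarterPeriod (quarterPeriodDeriv σ) σ :=
  hasDerivAt_angleTime_left σ _

theorem continuous_quarterPeriod : Continuous quarterPeriod :=
  continuous_angleTime.uncurry_right _

theorem continuous_quarterPeriodDeriv : Continuous quarterPeriodDeriv :=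
  continuous_angleTimeDeriv.uncurry_right _

theorem angleTime_zero (σ : ℝ) : angleTime σ 0 = 0 := by simp [angleTime]

theorem strictMono_angleTime (σ : ℝ) : StrictMono (angleTime σ) :=
  strictMono_of_deriv_pos fun τ => by
    rw [(hasDerivAt_angleTime_right σ τ).deriv]
    exact density_pos σ τ

theorem quarterPeriod_pos (σ : ℝ) : 0 < quarterPeriod σ := by
  rw [← angleTime_zero σ]
  exact strictMono_angleTime σ (by positivity)

theorem quarterPeriodDeriv_neg (σ : ℝ) : quarterPeriodDeriv σ < 0 := by
  have h : 0 < ∫ t in (0 : ℝ)..(Real.pi / 2), -densityDeriv σ t :=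
    intervalIntegral.intervalIntegral_pos_of_pos
      ((continuous_densityDeriv_right σ).neg.intervalIntegrable _ _)
      (fun t => neg_pos.2 (densityDeriv_neg σ t)) (by positivity)
  rw [intervalIntegral.integral_neg] at h
  exact neg_pos.1 h

theorem periodic_density (σ : ℝ) : Function.Periodic (density σ) Real.pi := by
  intro t
  simp [density, quartic, Real.cos_add_pi, Even.neg_pow (show Even 4 by decide)]

theorem angleTime_sub (σ x y : ℝ) :
    angleTime σ y - angleTime σ x = ∫ t in x..y, density σ t :=
  intervalIntegral.integral_interval_sub_left
    ((continuous_density_right σ).intervalIntegrable _ _)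
    ((continuous_density_right σ).intervalIntegrable _ _)

theorem angleTime_pi (σ : ℝ) : angleTime σ Real.pi = 2 * quarterPeriod σ := by
  have h1 := angleTime_sub σ (Real.pi / 2) Real.pi
  have h2 : ∫ t in (Real.pi / 2)..Real.pi, density σ t = quarterPeriod σ := by
    have := intervalIntegral.integral_comp_sub_left (a := 0) (b := Real.pi / 2)
      (density σ) Real.pi
    have h3 : ∀ t, density σ (Real.pi - t) = density σ t := by
      intro t
      simp [density, quartic, Real.cos_pi_sub, Even.neg_pow (show Even 4 by decide)]
    simp only [h3, sub_zero] at this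
    rw [quarterPeriod, angleTime, this]
    congr 1
    ring
  rw [h2] at h1
  unfold quarterPeriod at *
  linarith

theorem angleTime_add_pi (σ τ : ℝ) :
    angleTime σ (τ + Real.pi) = angleTime σ τ + 2 * quarterPeriod σ := by
  have h1 := angleTime_sub σ τ (τ + Real.pi)
  rw [(periodic_density σ).intervalIntegral_add_eq τ 0, zero_add] at h1
  rw [← angleTime_pi]
  unfold angleTime at *
  linarith

theorem angleTime_two_pi (σ : ℝ) : angleTime σ (2 * Real.pi) = 4 * quarterPeriod σ := by
  rw [two_mul, angleTime_add_pi, angleTime_pi]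
  ring

theorem density_ge (σ t : ℝ) : 1 / √(2 + Real.exp σ) ≤ density σ t := by
  refine one_div_le_one_div_of_le (sqrt_quartic_pos σ t) (Real.sqrt_le_sqrt ?_)
  unfold quartic
  nlinarith [Real.cos_sq_le_one t, sq_nonneg (Real.cos t)]

theorem mul_sub_le_angleTime_sub (σ : ℝ) {x y : ℝ} (h : x ≤ y) :
    1 / √(2 + Real.exp σ) * (y - x) ≤ angleTime σ y - angleTime σ x := by
  rw [angleTime_sub]
  have := intervalIntegral.integral_mono_on (μ := volume) h
    (f := fun _ => 1 / √(2 + Real.exp σ)) (g := density σ)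
    (by simp) ((continuous_density_right σ).intervalIntegrable _ _)
    (fun t _ => density_ge σ t)
  rw [intervalIntegral.integral_const, smul_eq_mul] at this
  linarith

theorem surjective_angleTime (σ : ℝ) : Function.Surjective (angleTime σ) := by
  have hc : 0 < 1 / √(2 + Real.exp σ) := by positivity
  have hcont : Continuous (angleTime σ) :=
    continuous_iff_continuousAt.2 fun τ => (hasDerivAt_angleTime_right σ τ).continuousAt
  refine hcont.surjective ?_ ?_
  · refine tendsto_atTop_mono' _ ?_ (tendsto_id.const_mul_atTop hc)
    filter_upwards [eventually_ge_atTop 0] with x hx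
    have := mul_sub_le_angleTime_sub σ hx
    rw [angleTime_zero] at this
    simpa using this
  · refine tendsto_atBot_mono' _ ?_ (tendsto_id.const_mul_atBot hc)
    filter_upwards [eventually_le_atBot 0] with x hx
    have := mul_sub_le_angleTime_sub σ hx
    rw [angleTime_zero] at this
    simp only [id]
    linarith

/-! ### The angle as a function of the space variable -/

/-- The angle at time `y`, where time is measured in quarter periods. -/
def angle (σ y : ℝ) : ℝ := Function.invFun (angleTime σ) (quarterPeriod σ * y)

theorem angleTime_angle (σ y : ℝ) : angleTime σ (angle σ y) = quarterPeriod σ * y :=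
  Function.rightInverse_invFun (surjective_angleTime σ) _

theorem eq_angle_of_angleTime_eq {σ τ y : ℝ} (h : angleTime σ τ = quarterPeriod σ * y) :
    τ = angle σ y :=
  (strictMono_angleTime σ).injective (h.trans (angleTime_angle σ y).symm)

theorem angle_add_four (σ y : ℝ) : angle σ (y + 4) = angle σ y + 2 * Real.pi := by
  symm
  apply eq_angle_of_angleTime_eq
  rw [show angle σ y + 2 * Real.pi = (angle σ y + Real.pi) + Real.pi by ring,
    angleTime_add_pi, angleTime_add_pi, angleTime_angle]
  ring

/-- The partial derivative of `angle` in `σ`. -/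
def angleDeriv (σ y : ℝ) : ℝ :=
  (quarterPeriodDeriv σ * y - angleTimeDeriv σ (angle σ y)) * √(quartic σ (angle σ y))

/-- The implicit function theorem applied to `angleTime σ τ = quarterPeriod σ * y`. -/
theorem hasStrictFDerivAt_angle (σ y : ℝ) :
    HasStrictFDerivAt angle.uncurry
      (angleDeriv σ y • ContinuousLinearMap.fst ℝ ℝ ℝ +
        (quarterPeriod σ * √(quartic σ (angle σ y))) • ContinuousLinearMap.snd ℝ ℝ ℝ) (σ, y) := by
  set f : ℝ × ℝ → ℝ → ℝ := fun p τ => angleTime p.1 τ - quarterPeriod p.1 * p.2 with hf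
  set f₁ : ℝ × ℝ → ℝ → (ℝ × ℝ →L[ℝ] ℝ) := fun p τ =>
    (angleTimeDeriv p.1 τ - quarterPeriodDeriv p.1 * p.2) • ContinuousLinearMap.fst ℝ ℝ ℝ -
      quarterPeriod p.1 • ContinuousLinearMap.snd ℝ ℝ ℝ with hf₁
  set f₂ : ℝ × ℝ → ℝ → (ℝ →L[ℝ] ℝ) := fun p τ =>
    density p.1 τ • ContinuousLinearMap.id ℝ ℝ with hf₂
  have df₁ : ∀ᶠ v in 𝓝 ((σ, y), angle σ y), HasFDerivAt (f · v.2) (f₁ v.1 v.2) v.1 := by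
    refine Eventually.of_forall fun v => ?_
    have h1 := (hasDerivAt_angleTime_left v.1.1 v.2).comp_hasFDerivAt v.1
      (hasFDerivAt_fst (𝕜 := ℝ) (E := ℝ) (F := ℝ) (p := v.1))
    have h2 := (hasDerivAt_quarterPeriod v.1.1).comp_hasFDerivAt v.1
      (hasFDerivAt_fst (𝕜 := ℝ) (E := ℝ) (F := ℝ) (p := v.1))
    have h3 := h1.sub (h2.mul (hasFDerivAt_snd (𝕜 := ℝ) (E := ℝ) (F := ℝ) (p := v.1)))
    convert! h3 using 1
    ext <;> simp [hf₁] <;> ring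
  have df₂ : ∀ᶠ v in 𝓝 ((σ, y), angle σ y), HasFDerivAt (f v.1 ·) (f₂ v.1 v.2) v.2 :=
    Eventually.of_forall fun v =>
      ((hasDerivAt_angleTime_right v.1.1 v.2).sub_const _).hasFDerivAt.congr_fderiv
        (by ext; simp [hf₂])
  have cf₁ : ContinuousAt ↿f₁ ((σ, y), angle σ y) := by
    refine Continuous.continuousAt ?_
    have h1 : Continuous fun v : (ℝ × ℝ) × ℝ => angleTimeDeriv v.1.1 v.2 :=
      continuous_angleTimeDeriv.comp₂ (continuous_fst.comp continuous_fst) continuous_snd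
    have h2 : Continuous fun v : (ℝ × ℝ) × ℝ => quarterPeriod v.1.1 :=
      continuous_quarterPeriod.comp (continuous_fst.comp continuous_fst)
    have h3 : Continuous fun v : (ℝ × ℝ) × ℝ => quarterPeriodDeriv v.1.1 :=
      continuous_quarterPeriodDeriv.comp (continuous_fst.comp continuous_fst)
    exact ((h1.sub (h3.mul (continuous_snd.comp continuous_fst))).smul continuous_const).sub
      (h2.smul continuous_const)
  have cf₂ : ContinuousAt ↿f₂ ((σ, y), angle σ y) := by
    refine Continuous.continuousAt ?_
    change Continuous fun v : (ℝ × ℝ) × ℝ => f₂ v.1 v.2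
    have h1 : Continuous fun v : (ℝ × ℝ) × ℝ => density v.1.1 v.2 :=
      continuous_density.comp₂ (continuous_fst.comp continuous_fst) continuous_snd
    exact h1.smul continuous_const
  have hd := density_pos σ (angle σ y)
  set e : ℝ ≃L[ℝ] ℝ := ContinuousLinearEquiv.unitsEquivAut ℝ (Units.mk0 _ hd.ne') with he
  have hfe : f₂ (σ, y) (angle σ y) = e := by
    ext
    simp [hf₂, he]
  have inv : (f₂ (σ, y) (angle σ y)).IsInvertible := ⟨e, hfe.symm⟩
  have key := hasStrictFDerivAt_implicitFunctionOfBivariate df₁ df₂ cf₁ cf₂ inv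
  have hev := eventually_apply_implicitFunctionOfBivariate df₁ df₂ cf₁ cf₂ inv
  refine (key.congr_fderiv ?_).congr_of_eventuallyEq ?_
  · have h1 : (f₂ (σ, y) (angle σ y)).inverse = (e.symm : ℝ →L[ℝ] ℝ) := by
      rw [hfe, ContinuousLinearMap.inverse_equiv]
    have h2 := sqrt_quartic_pos σ (angle σ y)
    rw [h1]
    ext <;> simp [he, hf₁, angleDeriv, density] <;> field_simp <;> ring
  · filter_upwards [hev] with p hp
    refine eq_angle_of_angleTime_eq ?_
    simp only [hf, angleTime_angle, sub_self] at hp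
    linarith

theorem continuous_angle : Continuous angle.uncurry :=
  continuous_iff_continuousAt.2 fun p => (hasStrictFDerivAt_angle p.1 p.2).continuousAt

theorem hasDerivAt_angle_left (σ y : ℝ) :
    HasDerivAt (fun σ => angle σ y) (angleDeriv σ y) σ := by
  have h := (hasStrictFDerivAt_angle σ y).hasFDerivAt.comp_hasDerivAt σ
    ((hasDerivAt_id σ).prodMk (hasDerivAt_const σ y))
  simpa [Function.comp_def, Function.uncurry] using h

theorem hasDerivAt_angle_right (σ y : ℝ) :
    HasDerivAt (angle σ) (quarterPeriod σ * √(quartic σ (angle σ y))) y := by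
  have h := (hasStrictFDerivAt_angle σ y).hasFDerivAt.comp_hasDerivAt y
    ((hasDerivAt_const y σ).prodMk (hasDerivAt_id y))
  simpa [Function.comp_def, Function.uncurry] using h

theorem continuous_angleDeriv : Continuous angleDeriv.uncurry := by
  have h1 : Continuous fun p : ℝ × ℝ => angle p.1 p.2 := continuous_angle
  have h2 := continuous_quarterPeriodDeriv
  have h3 : Continuous fun p : ℝ × ℝ => angleTimeDeriv p.1 (angle p.1 p.2) :=
    continuous_angleTimeDeriv.comp₂ continuous_fst h1
  have h4 : Continuous fun p : ℝ × ℝ => quartic p.1 (angle p.1 p.2) :=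
    continuous_quartic.comp₂ continuous_fst h1
  exact (((h2.comp continuous_fst).mul continuous_snd).sub h3).mul h4.sqrt

/-! ### A change of angle -/

/-- The angle `τ` with `tan τ = c tan θ`, extended smoothly to all real `θ`. -/
def tanScale (c θ : ℝ) : ℝ :=
  θ + Real.arctan ((c - 1) * (Real.sin θ * Real.cos θ) / (Real.cos θ ^ 2 + c * Real.sin θ ^ 2))

theorem cos_sq_add_mul_sin_sq_pos {c : ℝ} (hc : 0 < c) (θ : ℝ) :
    0 < Real.cos θ ^ 2 + c * Real.sin θ ^ 2 := by
  rcases le_total 1 c with h | h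
  · nlinarith [Real.sin_sq_add_cos_sq θ, sq_nonneg (Real.sin θ)]
  · nlinarith [Real.sin_sq_add_cos_sq θ, sq_nonneg (Real.cos θ)]

theorem sq_add_sq_tanScale (c θ : ℝ) :
    (Real.cos θ ^ 2 + c * Real.sin θ ^ 2) ^ 2 + ((c - 1) * (Real.sin θ * Real.cos θ)) ^ 2 =
      Real.cos θ ^ 2 + c ^ 2 * Real.sin θ ^ 2 := by
  linear_combination (Real.cos θ ^ 2 + c ^ 2 * Real.sin θ ^ 2) * Real.sin_sq_add_cos_sq θ

theorem hasDerivAt_tanScale {c : ℝ} (hc : 0 < c) (θ : ℝ) :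
    HasDerivAt (tanScale c) (c / (Real.cos θ ^ 2 + c ^ 2 * Real.sin θ ^ 2)) θ := by
  have hD := cos_sq_add_mul_sin_sq_pos hc θ
  have hE := cos_sq_add_mul_sin_sq_pos (pow_pos hc 2) θ
  have hs := Real.hasDerivAt_sin θ
  have hco := Real.hasDerivAt_cos θ
  have h := (hasDerivAt_id' θ).fun_add ((((hs.fun_mul hco).const_mul (c - 1)).fun_div
    ((hco.fun_pow 2).fun_add ((hs.fun_pow 2).const_mul c)) hD.ne').arctan)
  convert! h using 1
  have key := sq_add_sq_tanScale c θ
  have h1 : 1 + ((c - 1) * (Real.sin θ * Real.cos θ) /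
      (Real.cos θ ^ 2 + c * Real.sin θ ^ 2)) ^ 2 =
      (Real.cos θ ^ 2 + c ^ 2 * Real.sin θ ^ 2) / (Real.cos θ ^ 2 + c * Real.sin θ ^ 2) ^ 2 := by
    rw [← key]
    field_simp
  rw [h1]
  have h2 := Real.sin_sq θ
  field_simp
  simp only [Nat.cast_ofNat, Nat.add_one_sub_one, pow_one]
  ring_nf
  rw [show Real.sin θ ^ 4 = (Real.sin θ ^ 2) ^ 2 by ring, h2]
  ring

theorem tanScale_zero (c : ℝ) : tanScale c 0 = 0 := by simp [tanScale]

theorem tanScale_pi_div_two (c : ℝ) : tanScale c (Real.pi / 2) = Real.pi / 2 := by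
  simp [tanScale]

theorem cos_tanScale {c : ℝ} (hc : 0 < c) (θ : ℝ) :
    Real.cos (tanScale c θ) = Real.cos θ / √(Real.cos θ ^ 2 + c ^ 2 * Real.sin θ ^ 2) := by
  have hD := cos_sq_add_mul_sin_sq_pos hc θ
  have hE := cos_sq_add_mul_sin_sq_pos (pow_pos hc 2) θ
  have h1 : √(1 + ((c - 1) * (Real.sin θ * Real.cos θ) /
      (Real.cos θ ^ 2 + c * Real.sin θ ^ 2)) ^ 2) =
      √(Real.cos θ ^ 2 + c ^ 2 * Real.sin θ ^ 2) / (Real.cos θ ^ 2 + c * Real.sin θ ^ 2) := by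
    rw [← Real.sqrt_sq hD.le, ← Real.sqrt_div hE.le, Real.sqrt_sq hD.le, ← sq_add_sq_tanScale]
    congr 1
    field_simp
  rw [tanScale, Real.cos_add, Real.cos_arctan, Real.sin_arctan, h1]
  have hE' := Real.sqrt_pos.2 hE
  field_simp
  rw [Real.sin_sq]
  ring

/-! ### The frequency as a function of the parameter -/

/-- The frequency of the wave of period `L` and parameter `exp σ`. -/
def freq (L σ : ℝ) : ℝ := 16 * (1 - Real.exp σ) * quarterPeriod σ ^ 2 / L ^ 2

/-- The derivative of `freq` in `σ`. -/
def freqDeriv (L σ : ℝ) : ℝ :=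
  16 * (2 * (1 - Real.exp σ) * quarterPeriod σ * quarterPeriodDeriv σ -
    Real.exp σ * quarterPeriod σ ^ 2) / L ^ 2

theorem hasDerivAt_freq (L σ : ℝ) : HasDerivAt (freq L) (freqDeriv L σ) σ := by
  have h := (((((Real.hasDerivAt_exp σ).const_sub 1).const_mul 16).mul
    ((hasDerivAt_quarterPeriod σ).pow 2))).div_const (L ^ 2)
  convert! h using 1
  simp [freqDeriv]
  ring

/-- Both factors `1 - exp σ` and `quarterPeriod σ` of the frequency decrease. -/
theorem freqDeriv_neg {L : ℝ} (hL : 0 < L) {σ : ℝ} (hσ : Real.exp σ < 1) : freqDeriv L σ < 0 := by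
  have h1 := quarterPeriod_pos σ
  have h2 := quarterPeriodDeriv_neg σ
  have h3 : 0 < (1 - Real.exp σ) * quarterPeriod σ * -quarterPeriodDeriv σ :=
    mul_pos (mul_pos (by linarith) h1) (by linarith)
  have h4 := mul_pos (Real.exp_pos σ) (pow_pos h1 2)
  refine div_neg_of_neg_of_pos ?_ (by positivity)
  linarith

theorem continuous_freq (L : ℝ) : Continuous (freq L) :=
  continuous_iff_continuousAt.2 fun σ => (hasDerivAt_freq L σ).continuousAt

theorem continuous_freqDeriv (L : ℝ) : Continuous (freqDeriv L) := by
  have h1 := continuous_quarterPeriod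
  have h2 := continuous_quarterPeriodDeriv
  unfold freqDeriv
  fun_prop

theorem strictAntiOn_freq {L : ℝ} (hL : 0 < L) : StrictAntiOn (freq L) (Iio 0) := by
  refine strictAntiOn_of_deriv_neg (convex_Iio 0) (continuous_freq L).continuousOn fun σ hσ => ?_
  rw [interior_Iio] at hσ
  rw [(hasDerivAt_freq L σ).deriv]
  exact freqDeriv_neg hL (Real.exp_lt_one_iff.2 hσ)

/-- At `exp σ = 1/4` the quartic is a square and the period integral is elementary. -/
theorem quarterPeriod_log_quarter : quarterPeriod (Real.log (1 / 4)) = Real.pi / √3 := by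
  have h3 : (0 : ℝ) < √3 := by positivity
  have h33 : √3 ^ 2 = (3 : ℝ) := Real.sq_sqrt (by norm_num)
  have hd : ∀ t, density (Real.log (1 / 4)) t =
      2 / √3 * ((1 / √3) / (Real.cos t ^ 2 + (1 / √3) ^ 2 * Real.sin t ^ 2)) := by
    intro t
    have h1 : quartic (Real.log (1 / 4)) t = (Real.cos t ^ 2 + 1 / 2) ^ 2 := by
      rw [quartic, Real.exp_log (by norm_num)]
      ring
    rw [density, h1, Real.sqrt_sq (by positivity), div_pow, h33, Real.sin_sq]
    have : 0 < Real.cos t ^ 2 + 1 / 2 := by positivity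
    rw [show Real.cos t ^ 2 + 1 ^ 2 / 3 * (1 - Real.cos t ^ 2) =
      2 / 3 * (Real.cos t ^ 2 + 1 / 2) by ring]
    field_simp
    rw [h33]
  have hc : (0 : ℝ) < 1 / √3 := by positivity
  have hint : ∫ t in (0 : ℝ)..(Real.pi / 2),
      (1 / √3) / (Real.cos t ^ 2 + (1 / √3) ^ 2 * Real.sin t ^ 2) = Real.pi / 2 := by
    rw [intervalIntegral.integral_eq_sub_of_hasDerivAt (f := tanScale (1 / √3))
      (fun t _ => hasDerivAt_tanScale hc t), tanScale_zero, tanScale_pi_div_two, sub_zero]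
    refine Continuous.intervalIntegrable (continuous_const.div (by fun_prop) fun t => ?_) _ _
    exact (cos_sq_add_mul_sin_sq_pos (pow_pos hc 2) t).ne'
  rw [quarterPeriod, angleTime]
  simp only [hd]
  rw [intervalIntegral.integral_const_mul, hint]
  field_simp

theorem freq_log_quarter (L : ℝ) : freq L (Real.log (1 / 4)) = 4 * Real.pi ^ 2 / L ^ 2 := by
  rw [freq, quarterPeriod_log_quarter, Real.exp_log (by norm_num), div_pow,
    Real.sq_sqrt (by norm_num)]
  ring

/-- The period blows up at least logarithmically as `exp σ → 0`. -/
theorem neg_div_four_le_quarterPeriod (σ : ℝ) : -σ / 4 ≤ quarterPeriod σ := by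
  have hδ := Real.exp_pos (σ / 2)
  have hδ2 : Real.exp (σ / 2) ^ 2 = Real.exp σ := by
    rw [← Real.exp_nat_mul]
    congr 1
    push_cast
    ring
  -- `quartic σ t ≤ 2 u² + δ² ≤ (2 u + δ)²` for `u = π / 2 - t`, and `1 / (2 u + δ)` has an
  -- elementary primitive
  set δ := Real.exp (σ / 2) with hδdef
  have hpos : ∀ t ∈ Icc (0 : ℝ) (Real.pi / 2), 0 < 2 * (Real.pi / 2 - t) + δ := fun t ht => by
    linarith [ht.2]
  have hle : ∀ t ∈ Icc (0 : ℝ) (Real.pi / 2), 1 / (2 * (Real.pi / 2 - t) + δ) ≤ density σ t := by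
    intro t ht
    refine one_div_le_one_div_of_le (sqrt_quartic_pos σ t) ?_
    refine Real.sqrt_le_iff.2 ⟨(hpos t ht).le, ?_⟩
    have h0 : 0 ≤ Real.pi / 2 - t := by linarith [ht.2]
    have h1 : Real.cos t ≤ Real.pi / 2 - t := by
      rw [← Real.sin_pi_div_two_sub]
      exact Real.sin_le h0
    have h2 : 0 ≤ Real.cos t := Real.cos_nonneg_of_mem_Icc ⟨by linarith [ht.1, Real.pi_pos], ht.2⟩
    have h3 : Real.cos t ^ 4 ≤ Real.cos t ^ 2 := by
      nlinarith [Real.cos_sq_le_one t, sq_nonneg (Real.cos t)]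
    have h4 : Real.cos t ^ 2 ≤ (Real.pi / 2 - t) ^ 2 := by gcongr
    rw [quartic, ← hδ2]
    nlinarith [mul_nonneg h0 hδ.le]
  have hint : ∫ t in (0 : ℝ)..(Real.pi / 2), 1 / (2 * (Real.pi / 2 - t) + δ) =
      1 / 2 * (Real.log (Real.pi + δ) - Real.log δ) := by
    rw [intervalIntegral.integral_eq_sub_of_hasDerivAt
      (f := fun t => -(1 / 2) * Real.log (2 * (Real.pi / 2 - t) + δ))]
    · simp only [sub_self, mul_zero, zero_add, sub_zero]
      rw [show 2 * (Real.pi / 2) = Real.pi by ring]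
      ring
    · intro t ht
      rw [uIcc_of_le (by positivity)] at ht
      have h1 : HasDerivAt (fun t => 2 * (Real.pi / 2 - t) + δ) (-2) t := by
        have := (((hasDerivAt_id t).const_sub (Real.pi / 2)).const_mul 2).add_const δ
        simpa using this
      have h2 := (h1.log (hpos t ht).ne').const_mul (-(1 / 2))
      convert! h2 using 1
      ring
    · refine ContinuousOn.intervalIntegrable ?_
      rw [uIcc_of_le (by positivity)]
      exact continuousOn_const.div (by fun_prop) fun t ht => (hpos t ht).ne'
  have hmono : ∫ t in (0 : ℝ)..(Real.pi / 2), 1 / (2 * (Real.pi / 2 - t) + δ) ≤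
      quarterPeriod σ := by
    refine intervalIntegral.integral_mono_on (by positivity) ?_
      ((continuous_density_right σ).intervalIntegrable _ _) hle
    refine ContinuousOn.intervalIntegrable ?_
    rw [uIcc_of_le (by positivity)]
    exact continuousOn_const.div (by fun_prop) fun t ht => (hpos t ht).ne'
  have hlog : 0 ≤ Real.log (Real.pi + δ) := Real.log_nonneg (by linarith [Real.pi_gt_three])
  have hlog2 : Real.log δ = σ / 2 := by rw [hδdef, Real.log_exp]
  rw [hint, hlog2] at hmono
  linarith

theorem exists_freq_eq {L : ℝ} (hL : 0 < L) {ω : ℝ} (hω : 4 * Real.pi ^ 2 / L ^ 2 < ω) :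
    ∃ σ, Real.exp σ < 1 / 4 ∧ freq L σ = ω := by
  have hlog : ∀ {σ : ℝ}, σ < Real.log (1 / 4) ↔ Real.exp σ < 1 / 4 := fun {σ} =>
    Real.lt_log_iff_exp_lt (by norm_num)
  -- at this value, `freq L` is already at least `ω`
  set σ₀ := min (Real.log (1 / 4) - 1) (-(4 * (L * √ω))) with hσ₀
  have h0 : 0 < ω := lt_of_le_of_lt (by positivity) hω
  have h1 : σ₀ < Real.log (1 / 4) := (min_le_left _ _).trans_lt (by linarith)
  have h2 : L * √ω ≤ quarterPeriod σ₀ := by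
    have := neg_div_four_le_quarterPeriod σ₀
    have h3 : σ₀ ≤ -(4 * (L * √ω)) := min_le_right _ _
    linarith
  have h4 : ω ≤ freq L σ₀ := by
    have h5 := hlog.1 h1
    rw [freq, le_div_iff₀ (by positivity)]
    have h6 : ω * L ^ 2 ≤ quarterPeriod σ₀ ^ 2 := by
      calc ω * L ^ 2 = (L * √ω) ^ 2 := by rw [mul_pow, Real.sq_sqrt h0.le]; ring
        _ ≤ _ := by gcongr
    nlinarith [sq_nonneg (quarterPeriod σ₀)]
  have h7 : freq L (Real.log (1 / 4)) < ω := by rwa [freq_log_quarter]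
  obtain ⟨σ, hσ, hσω⟩ := intermediate_value_Icc' h1.le (continuous_freq L).continuousOn
    ⟨h7.le, h4⟩
  refine ⟨σ, hlog.1 (lt_of_le_of_ne hσ.2 ?_), hσω⟩
  rintro rfl
  exact h7.ne hσω

/-! ### The mass as a function of the parameter -/

/-- The mass of the wave, up to a constant factor, as an integral over the angle. -/
def massIntegral (σ : ℝ) : ℝ := ∫ t in (0 : ℝ)..(2 * Real.pi), Real.cos t ^ 2 * density σ t

/-- The integrand of the mass decreases pointwise in the parameter. -/
theorem exists_hasDerivAt_massIntegral_neg (σ : ℝ) : ∃ m < 0, HasDerivAt massIntegral m σ := by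
  have hc : Continuous fun p : ℝ × ℝ => Real.cos p.2 ^ 2 := by fun_prop
  have h1 : Continuous fun p : ℝ × ℝ => Real.cos p.2 ^ 2 * density p.1 p.2 :=
    hc.mul continuous_density
  have h2 : Continuous fun p : ℝ × ℝ => Real.cos p.2 ^ 2 * densityDeriv p.1 p.2 :=
    hc.mul continuous_densityDeriv
  refine ⟨∫ t in (0 : ℝ)..(2 * Real.pi), Real.cos t ^ 2 * densityDeriv σ t, ?_,
    hasDerivAt_intervalIntegral_of_continuous (F := fun σ t => Real.cos t ^ 2 * density σ t)
      (F' := fun σ t => Real.cos t ^ 2 * densityDeriv σ t)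
      h1 h2 (fun s t => (hasDerivAt_density s t).const_mul _) _ _ _⟩
  have h : 0 < ∫ t in (0 : ℝ)..(2 * Real.pi), -(Real.cos t ^ 2 * densityDeriv σ t) := by
    refine intervalIntegral.integral_pos (by positivity) ?_ (fun t _ => ?_)
      ⟨0, ⟨le_rfl, by positivity⟩, ?_⟩
    · have := continuous_densityDeriv_right σ
      fun_prop
    · nlinarith [densityDeriv_neg σ t, sq_nonneg (Real.cos t)]
    · simpa using densityDeriv_neg σ 0
  rw [intervalIntegral.integral_neg] at h
  exact neg_pos.1 h

/-! ### The wave in the angular parametrization -/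

/-- The maximum of the wave. -/
def crest (L C σ : ℝ) : ℝ := C * √(4 * √3 * quarterPeriod σ / L)

/-- The derivative of `crest` in `σ`. -/
def crestDeriv (L C σ : ℝ) : ℝ :=
  C * ((4 * √3 * quarterPeriodDeriv σ / L) / (2 * √(4 * √3 * quarterPeriod σ / L)))

/-- The wave of period `L` and parameter `exp σ`. -/
def angularWave (L C σ x : ℝ) : ℝ := crest L C σ * Real.cos (angle σ (4 / L * x))

/-- The derivative of `angularWave` in the parameter `σ`. -/
def angularWaveDeriv (L C σ x : ℝ) : ℝ :=
  crestDeriv L C σ * Real.cos (angle σ (4 / L * x)) +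
    crest L C σ * (-Real.sin (angle σ (4 / L * x)) * angleDeriv σ (4 / L * x))

theorem crest_radicand_pos {L : ℝ} (hL : 0 < L) (σ : ℝ) : 0 < 4 * √3 * quarterPeriod σ / L := by
  have := quarterPeriod_pos σ
  positivity

theorem crest_sq {L : ℝ} (hL : 0 < L) (C : ℝ) (σ : ℝ) :
    crest L C σ ^ 2 = C ^ 2 * (4 * √3 * quarterPeriod σ / L) := by
  rw [crest, mul_pow, Real.sq_sqrt (crest_radicand_pos hL σ).le]

theorem hasDerivAt_crest {L : ℝ} (hL : 0 < L) (C : ℝ) (σ : ℝ) :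
    HasDerivAt (crest L C) (crestDeriv L C σ) σ := by
  have h := (((hasDerivAt_quarterPeriod σ).const_mul (4 * √3)).div_const L).sqrt
    (crest_radicand_pos hL σ).ne'
  exact h.const_mul C

theorem continuous_crest {L : ℝ} (hL : 0 < L) (C : ℝ) : Continuous (crest L C) :=
  continuous_iff_continuousAt.2 fun σ => (hasDerivAt_crest hL C σ).continuousAt

theorem continuous_crestDeriv {L : ℝ} (hL : 0 < L) (C : ℝ) : Continuous (crestDeriv L C) := by
  have h1 := continuous_quarterPeriod
  have h2 := continuous_quarterPeriodDeriv
  refine continuous_const.mul (Continuous.div (by fun_prop) (by fun_prop) fun σ => ?_)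
  exact (mul_pos two_pos (Real.sqrt_pos.2 (crest_radicand_pos hL σ))).ne'

theorem continuous_angularWave {L : ℝ} (hL : 0 < L) (C : ℝ) :
    Continuous (angularWave L C).uncurry := by
  have h1 := continuous_crest hL C
  have h2 : Continuous fun p : ℝ × ℝ => angle p.1 (4 / L * p.2) :=
    continuous_angle.comp₂ continuous_fst (continuous_const.mul continuous_snd)
  exact (h1.comp continuous_fst).mul (Real.continuous_cos.comp h2)

theorem continuous_angularWaveDeriv {L : ℝ} (hL : 0 < L) (C : ℝ) :
    Continuous (angularWaveDeriv L C).uncurry := by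
  have h1 := continuous_crest hL C
  have h1' := continuous_crestDeriv hL C
  have h2 : Continuous fun p : ℝ × ℝ => angle p.1 (4 / L * p.2) :=
    continuous_angle.comp₂ continuous_fst (continuous_const.mul continuous_snd)
  have h3 : Continuous fun p : ℝ × ℝ => angleDeriv p.1 (4 / L * p.2) :=
    continuous_angleDeriv.comp₂ continuous_fst (continuous_const.mul continuous_snd)
  exact ((h1'.comp continuous_fst).mul (Real.continuous_cos.comp h2)).add
    ((h1.comp continuous_fst).mul ((Real.continuous_sin.comp h2).neg.mul h3))

theorem hasDerivAt_angularWave_left {L : ℝ} (hL : 0 < L) (C : ℝ) (σ x : ℝ) :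
    HasDerivAt (fun σ => angularWave L C σ x) (angularWaveDeriv L C σ x) σ :=
  (hasDerivAt_crest hL C σ).mul (hasDerivAt_angle_left σ _).cos

theorem periodic_angularWave {L : ℝ} (hL : 0 < L) (C : ℝ) (σ : ℝ) :
    Function.Periodic (angularWave L C σ) L := by
  intro x
  have h : 4 / L * (x + L) = 4 / L * x + 4 := by field_simp
  rw [angularWave, h, angle_add_four, Real.cos_add_two_pi, angularWave]

/-- The `σ`-derivative of a family of functions with a common period has this period. -/
theorem periodic_angularWaveDeriv {L : ℝ} (hL : 0 < L) (C : ℝ) (σ : ℝ) :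
    Function.Periodic (angularWaveDeriv L C σ) L := by
  intro x
  refine (hasDerivAt_angularWave_left hL C σ (x + L)).unique ?_
  simpa only [fun s => periodic_angularWave hL C s x] using hasDerivAt_angularWave_left hL C σ x

/-- The derivative of `angularWave` in the space variable. -/
def angularWaveSlope (L C σ x : ℝ) : ℝ :=
  -(crest L C σ * (4 * quarterPeriod σ / L) *
    (Real.sin (angle σ (4 / L * x)) * √(quartic σ (angle σ (4 / L * x)))))

theorem hasDerivAt_angle_comp (L σ x : ℝ) :
    HasDerivAt (fun x => angle σ (4 / L * x))
      (4 * quarterPeriod σ / L * √(quartic σ (angle σ (4 / L * x)))) x := by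
  have h := (hasDerivAt_angle_right σ (4 / L * x)).comp x ((hasDerivAt_id x).const_mul (4 / L))
  convert! h using 1
  ring

theorem hasDerivAt_angularWave_right (L C σ x : ℝ) :
    HasDerivAt (angularWave L C σ) (angularWaveSlope L C σ x) x := by
  have h := (hasDerivAt_angle_comp L σ x).cos.const_mul (crest L C σ)
  convert! h using 1
  rw [angularWaveSlope]
  ring

theorem periodic_angularWaveSlope {L : ℝ} (hL : 0 < L) (C : ℝ) (σ : ℝ) :
    Function.Periodic (angularWaveSlope L C σ) L := by
  intro x
  have h : 4 / L * (x + L) = 4 / L * x + 4 := by field_simp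
  have h2 : √(quartic σ (angle σ (4 / L * x) + 2 * Real.pi)) =
      √(quartic σ (angle σ (4 / L * x))) := by
    simp [quartic]
  rw [angularWaveSlope, h, angle_add_four, h2, Real.sin_add_two_pi, angularWaveSlope]

/-- The profile equation `φ'' = ω φ - β φ⁵`. -/
theorem hasDerivAt_angularWaveSlope {L : ℝ} (hL : 0 < L) {C β : ℝ} (hβ : β * C ^ 4 = 1) (σ x : ℝ) :
    HasDerivAt (angularWaveSlope L C σ)
      (freq L σ * angularWave L C σ x - β * angularWave L C σ x ^ 5) x := by
  have ha := hasDerivAt_angle_comp L σ x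
  set τ := angle σ (4 / L * x) with hτ
  have hq : HasDerivAt (fun x => quartic σ (angle σ (4 / L * x))) _ x :=
    ((ha.cos.pow 4).add (ha.cos.pow 2)).add_const (Real.exp σ)
  have h := ((ha.sin.mul (hq.sqrt (quartic_pos σ τ).ne')).const_mul
    (crest L C σ * (4 * quarterPeriod σ / L))).neg
  convert! h using 1
  have hs := sqrt_quartic_pos σ τ
  have hs2 : √(quartic σ τ) ^ 2 = Real.cos τ ^ 4 + Real.cos τ ^ 2 + Real.exp σ :=
    Real.sq_sqrt (quartic_pos σ τ).le
  have h4 : β * crest L C σ ^ 4 = 48 * quarterPeriod σ ^ 2 / L ^ 2 := by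
    have h3 : √3 ^ 2 = (3 : ℝ) := Real.sq_sqrt (by norm_num)
    calc β * crest L C σ ^ 4 = β * (crest L C σ ^ 2) ^ 2 := by ring
      _ = (β * C ^ 4) * (16 * √3 ^ 2 * quarterPeriod σ ^ 2 / L ^ 2) := by
        rw [crest_sq hL]; ring
      _ = _ := by rw [hβ, h3]; ring
  have h5 : β * angularWave L C σ x ^ 5 =
      48 * quarterPeriod σ ^ 2 / L ^ 2 * (crest L C σ * Real.cos τ ^ 5) := by
    rw [← h4, angularWave]
    ring
  rw [h5, freq, angularWave, ← hτ]
  field_simp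
  rw [hs2, Real.sin_sq]
  push_cast
  ring

/-- Substituting the angle for the space variable in the mass. -/
theorem integral_angularWave_sq {L : ℝ} (hL : 0 < L) (C : ℝ) (σ : ℝ) :
    ∫ x in (0 : ℝ)..L, angularWave L C σ x ^ 2 = C ^ 2 * √3 * massIntegral σ := by
  have hP := quarterPeriod_pos σ
  have hX : ∀ τ, HasDerivAt (fun τ => L / (4 * quarterPeriod σ) * angleTime σ τ)
      (L / (4 * quarterPeriod σ) * density σ τ) τ :=
    fun τ => (hasDerivAt_angleTime_right σ τ).const_mul _
  have hsub := intervalIntegral.integral_comp_mul_deriv (a := 0) (b := 2 * Real.pi)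
    (f := fun τ => L / (4 * quarterPeriod σ) * angleTime σ τ)
    (f' := fun τ => L / (4 * quarterPeriod σ) * density σ τ)
    (g := fun x => angularWave L C σ x ^ 2) (fun τ _ => hX τ)
    (continuous_const.mul (continuous_density_right σ)).continuousOn
    (((continuous_angularWave hL C).uncurry_left σ).pow 2)
  simp only [angleTime_zero, angleTime_two_pi, mul_zero] at hsub
  rw [show L / (4 * quarterPeriod σ) * (4 * quarterPeriod σ) = L by field_simp] at hsub
  rw [← hsub, massIntegral, ← intervalIntegral.integral_const_mul]
  refine intervalIntegral.integral_congr fun τ _ => ?_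
  have h1 : angle σ (4 / L * (L / (4 * quarterPeriod σ) * angleTime σ τ)) = τ := by
    symm
    apply eq_angle_of_angleTime_eq
    field_simp
  simp only [Function.comp, angularWave]
  rw [h1, mul_pow, crest_sq hL]
  field_simp

/-! ### Comparison with the Jacobi parametrization -/

/-- The number `e = -1 / q ∈ (1/2, 1)` attached to the modulus `k`: the quadratic factor of the
first integral of the wave of modulus `k` is `(s + e) (s + 1 - e)`. -/
def rootE (k : ℝ) : ℝ := 1 / (1 - k ^ 2 + rootR k)

section rootE

variable {k : ℝ}

theorem rootR_sq (k : ℝ) : rootR k ^ 2 = k ^ 4 - k ^ 2 + 1 :=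
  Real.sq_sqrt (by nlinarith [sq_nonneg (k ^ 2 - 1 / 2)])

theorem rootR_nonneg (k : ℝ) : 0 ≤ rootR k := Real.sqrt_nonneg _

theorem sq_mem_Ioo (hk : k ∈ Ioo (0 : ℝ) 1) : k ^ 2 ∈ Ioo (0 : ℝ) 1 :=
  ⟨pow_pos hk.1 2, pow_lt_one₀ hk.1.le hk.2 two_ne_zero⟩

theorem one_lt_neg_paramQ (hk : k ∈ Ioo (0 : ℝ) 1) : 1 < 1 - k ^ 2 + rootR k := by
  have h := sq_mem_Ioo hk
  have : k ^ 2 < rootR k := Real.lt_sqrt_of_sq_lt (by nlinarith [h.2])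
  linarith

theorem neg_paramQ_lt_two (hk : k ∈ Ioo (0 : ℝ) 1) : 1 - k ^ 2 + rootR k < 2 := by
  have h := sq_mem_Ioo hk
  have : rootR k < 1 + k ^ 2 := (Real.sqrt_lt' (by linarith [h.1])).2 (by nlinarith [h.1])
  linarith

theorem rootE_mem (hk : k ∈ Ioo (0 : ℝ) 1) : rootE k ∈ Ioo (1 / 2 : ℝ) 1 := by
  have h1 := one_lt_neg_paramQ hk
  have h2 := neg_paramQ_lt_two hk
  exact ⟨one_div_lt_one_div_of_lt (by linarith) h2, (div_lt_one (by linarith)).2 h1⟩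

theorem one_div_rootE (k : ℝ) : 1 / rootE k = 1 - k ^ 2 + rootR k := by
  rw [rootE, one_div_one_div]

theorem paramQ_eq (k : ℝ) : paramQ k = -(1 / rootE k) := by
  rw [one_div_rootE, paramQ]
  ring

theorem sq_mul_rootE (hk : k ∈ Ioo (0 : ℝ) 1) :
    k ^ 2 * (rootE k * (2 - rootE k)) = 2 * rootE k - 1 := by
  have h1 := one_lt_neg_paramQ hk
  have h3 := rootR_sq k
  have h4 : 1 - k ^ 2 + rootR k ≠ 0 := by linarith
  rw [rootE]
  field_simp
  linear_combination h3

theorem rootR_mul_rootE (hk : k ∈ Ioo (0 : ℝ) 1) :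
    rootR k * (rootE k * (2 - rootE k)) = rootE k ^ 2 - rootE k + 1 := by
  have h1 := one_lt_neg_paramQ hk
  have h3 := rootR_sq k
  have h4 : 1 - k ^ 2 + rootR k ≠ 0 := by linarith
  rw [rootE]
  field_simp
  linear_combination h3

/-- The modulus is recovered from `rootE`, which parametrizes the curve `r² = k⁴ - k² + 1`
rationally. -/
theorem exists_rootE_eq {e : ℝ} (he : e ∈ Ioo (1 / 2 : ℝ) 1) :
    ∃ k ∈ Ioo (0 : ℝ) 1, rootE k = e := by
  obtain ⟨h1, h2⟩ := he
  have hd : 0 < e * (2 - e) := mul_pos (by linarith) (by linarith)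
  set m := (2 * e - 1) / (e * (2 - e)) with hm
  have hm0 : 0 < m := div_pos (by linarith) hd
  have hm1 : m < 1 := (div_lt_one hd).2 (by nlinarith)
  have hk2 : √m ^ 2 = m := Real.sq_sqrt hm0.le
  refine ⟨√m, ⟨Real.sqrt_pos.2 hm0, (Real.sqrt_lt' one_pos).2 (by simpa using hm1)⟩, ?_⟩
  have hr : rootR √m = (e ^ 2 - e + 1) / (e * (2 - e)) := by
    rw [rootR, show √m ^ 4 = (√m ^ 2) ^ 2 by ring, hk2]
    have h4 : m ^ 2 - m + 1 = ((e ^ 2 - e + 1) / (e * (2 - e))) ^ 2 := by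
      rw [hm]
      have h5 : 2 - e ≠ 0 := by linarith
      have h6 : e ≠ 0 := by linarith
      field_simp
      ring
    rw [h4, Real.sqrt_sq (div_nonneg (by nlinarith [sq_nonneg (e - 1)]) hd.le)]
  rw [rootE, hr, hk2, hm]
  have h5 : 2 - e ≠ 0 := by linarith
  have h6 : e ≠ 0 := by linarith
  rw [show 1 - (2 * e - 1) / (e * (2 - e)) + (e ^ 2 - e + 1) / (e * (2 - e)) = 1 / e by
    field_simp
    ring, one_div_one_div]

theorem rootE_injOn : InjOn rootE (Ioo 0 1) := by
  intro k hk l hl h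
  have h1 := sq_mul_rootE hk
  have h2 := sq_mul_rootE hl
  have he := rootE_mem hl
  rw [h] at h1
  have h3 : k ^ 2 = l ^ 2 :=
    mul_right_cancel₀ (mul_pos (by linarith [he.1]) (by linarith [he.2])).ne' (h1.trans h2.symm)
  exact (pow_left_inj₀ hk.1.le hl.1.le two_ne_zero).1 h3

/-- The parameter `σ` of the wave of modulus `k`. -/
def logParam (k : ℝ) : ℝ := Real.log (rootE k * (1 - rootE k))

theorem exp_logParam (hk : k ∈ Ioo (0 : ℝ) 1) :
    Real.exp (logParam k) = rootE k * (1 - rootE k) := by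
  have he := rootE_mem hk
  exact Real.exp_log (mul_pos (by linarith [he.1]) (by linarith [he.2]))

theorem exp_logParam_lt (hk : k ∈ Ioo (0 : ℝ) 1) : Real.exp (logParam k) < 1 / 4 := by
  rw [exp_logParam hk]
  nlinarith [(rootE_mem hk).1, sq_pos_of_pos (sub_pos.2 (rootE_mem hk).1)]

theorem logParam_neg (hk : k ∈ Ioo (0 : ℝ) 1) : logParam k < 0 :=
  Real.exp_lt_one_iff.1 ((exp_logParam_lt hk).trans (by norm_num))

theorem logParam_injOn : InjOn logParam (Ioo 0 1) := by
  intro k hk l hl h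
  have h1 := exp_logParam hk
  rw [h, exp_logParam hl] at h1
  have hek := rootE_mem hk
  have hel := rootE_mem hl
  refine rootE_injOn hk hl ?_
  have h2 : (rootE k - rootE l) * (rootE k + rootE l - 1) = 0 := by linarith
  rcases mul_eq_zero.1 h2 with h3 | h3
  · linarith
  · linarith [hek.1, hel.1]

theorem exists_logParam_eq {σ : ℝ} (hσ : Real.exp σ < 1 / 4) :
    ∃ k ∈ Ioo (0 : ℝ) 1, logParam k = σ := by
  have h0 : 0 < 1 - 4 * Real.exp σ := by linarith
  have h1 : √(1 - 4 * Real.exp σ) ^ 2 = 1 - 4 * Real.exp σ := Real.sq_sqrt h0.le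
  have h2 : 0 < √(1 - 4 * Real.exp σ) := Real.sqrt_pos.2 h0
  have h3 : √(1 - 4 * Real.exp σ) < 1 :=
    (Real.sqrt_lt' one_pos).2 (by linarith [Real.exp_pos σ])
  obtain ⟨k, hk, hke⟩ := exists_rootE_eq (e := (1 + √(1 - 4 * Real.exp σ)) / 2)
    ⟨by linarith, by linarith⟩
  refine ⟨k, hk, Real.exp_injective ?_⟩
  rw [exp_logParam hk, hke]
  linear_combination -h1 / 4

end rootE

theorem hasDerivAt_ellipticF {k : ℝ} (hk : k ∈ Ioo (0 : ℝ) 1) (θ : ℝ) :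
    HasDerivAt (ellipticF k) (1 / √(1 - k ^ 2 * Real.sin θ ^ 2)) θ :=
  ((continuous_integrand hk).integral_hasStrictDerivAt 0 θ).hasDerivAt

/-- The factor by which the Jacobi amplitude and the angle differ on the level of tangents. -/
def tanRatio (k : ℝ) : ℝ := √((1 + rootE k) / rootE k)

section link

variable {k : ℝ}

theorem tanRatio_pos (hk : k ∈ Ioo (0 : ℝ) 1) : 0 < tanRatio k := by
  have he := rootE_mem hk
  exact Real.sqrt_pos.2 (div_pos (by linarith [he.1]) (by linarith [he.1]))

theorem tanRatio_sq (hk : k ∈ Ioo (0 : ℝ) 1) : tanRatio k ^ 2 = (1 + rootE k) / rootE k := by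
  have he := rootE_mem hk
  exact Real.sq_sqrt (div_pos (by linarith [he.1]) (by linarith [he.1])).le

theorem cos_sq_add_tanRatio (hk : k ∈ Ioo (0 : ℝ) 1) (θ : ℝ) :
    Real.cos θ ^ 2 + tanRatio k ^ 2 * Real.sin θ ^ 2 = 1 - paramQ k * Real.sin θ ^ 2 := by
  have he : rootE k ≠ 0 := by linarith [(rootE_mem hk).1]
  rw [tanRatio_sq hk, paramQ_eq, Real.cos_sq']
  field_simp
  ring

/-- Both factors `s + e` and `s + 1 - e` of the quartic, at `s = cos² τ` with `tan τ = c tan θ`. -/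
theorem quartic_tanScale (hk : k ∈ Ioo (0 : ℝ) 1) (θ : ℝ) :
    quartic (logParam k) (tanScale (tanRatio k) θ) =
      (1 + rootE k) * (2 - rootE k) * (1 - k ^ 2 * Real.sin θ ^ 2) /
        (Real.cos θ ^ 2 + tanRatio k ^ 2 * Real.sin θ ^ 2) ^ 2 := by
  have hc := tanRatio_pos hk
  have hE := cos_sq_add_mul_sin_sq_pos (pow_pos hc 2) θ
  have he : rootE k ≠ 0 := by linarith [(rootE_mem hk).1]
  set e := rootE k with hedef
  set E := Real.cos θ ^ 2 + tanRatio k ^ 2 * Real.sin θ ^ 2 with hEdef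
  have hs : Real.cos (tanScale (tanRatio k) θ) ^ 2 = Real.cos θ ^ 2 / E := by
    rw [cos_tanScale hc, div_pow, Real.sq_sqrt hE.le]
  have hEe : E * e = e + Real.sin θ ^ 2 := by
    rw [hEdef, tanRatio_sq hk, Real.cos_sq', ← hedef]
    field_simp
    ring
  have hm := sq_mul_rootE hk
  rw [← hedef] at hm
  have h1 : Real.cos θ ^ 2 / E + e = (1 + e) / E := by
    field_simp
    rw [Real.cos_sq']
    linarith
  have h2 : Real.cos θ ^ 2 / E + (1 - e) = (2 - e) * (1 - k ^ 2 * Real.sin θ ^ 2) / E := by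
    field_simp
    refine mul_left_cancel₀ he ?_
    rw [Real.cos_sq']
    linear_combination (1 - e) * hEe + Real.sin θ ^ 2 * hm
  calc quartic (logParam k) (tanScale (tanRatio k) θ)
      = (Real.cos θ ^ 2 / E + e) * (Real.cos θ ^ 2 / E + (1 - e)) := by
        rw [quartic, exp_logParam hk, ← hedef,
          show Real.cos (tanScale (tanRatio k) θ) ^ 4 =
            (Real.cos (tanScale (tanRatio k) θ) ^ 2) ^ 2 by ring, hs]
        ring
    _ = _ := by
        rw [h1, h2]
        field_simp

/-- The substitution `tan τ = c tan θ` carries the elliptic integral of the first kind into the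
period integral of the wave. -/
theorem angleTime_tanScale (hk : k ∈ Ioo (0 : ℝ) 1) (θ : ℝ) :
    angleTime (logParam k) (tanScale (tanRatio k) θ) =
      1 / √(rootE k * (2 - rootE k)) * ellipticF k θ := by
  have hc := tanRatio_pos hk
  have hek := rootE_mem hk
  have he : 0 < rootE k := by linarith [hek.1]
  have he1 : 0 < 1 + rootE k := by linarith
  have he2 : 0 < 2 - rootE k := by linarith [hek.2]
  have hderiv : ∀ θ, HasDerivAt (fun θ => angleTime (logParam k) (tanScale (tanRatio k) θ) -
      1 / √(rootE k * (2 - rootE k)) * ellipticF k θ) 0 θ := by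
    intro θ
    have h := ((hasDerivAt_angleTime_right (logParam k) _).comp θ
      (hasDerivAt_tanScale hc θ)).fun_sub
      ((hasDerivAt_ellipticF hk θ).const_mul (1 / √(rootE k * (2 - rootE k))))
    convert! h using 1
    have hE := cos_sq_add_mul_sin_sq_pos (pow_pos hc 2) θ
    have hr := radicand_pos hk θ
    rw [density, quartic_tanScale hk, Real.sqrt_div (by positivity), Real.sqrt_sq hE.le,
      Real.sqrt_mul (by positivity), Real.sqrt_mul he1.le, Real.sqrt_mul he.le]
    have h1 : tanRatio k * √(rootE k) = √(1 + rootE k) := by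
      rw [tanRatio, Real.sqrt_div he1.le, div_mul_cancel₀ _ (Real.sqrt_pos.2 he).ne']
    have := Real.sqrt_pos.2 hr
    have := Real.sqrt_pos.2 he
    have := Real.sqrt_pos.2 he1
    have := Real.sqrt_pos.2 he2
    rw [← h1]
    field_simp
    ring
  have h := is_const_of_deriv_eq_zero (fun θ => (hderiv θ).differentiableAt)
    (fun θ => (hderiv θ).deriv) θ 0
  simp only [tanScale_zero, angleTime_zero, ellipticF_zero, mul_zero, sub_zero] at h
  linarith

theorem quarterPeriod_logParam (hk : k ∈ Ioo (0 : ℝ) 1) :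
    quarterPeriod (logParam k) = 1 / √(rootE k * (2 - rootE k)) * ellipticK k := by
  have h := angleTime_tanScale hk (Real.pi / 2)
  rwa [tanScale_pi_div_two] at h

theorem frequency_eq_freq (L : ℝ) (hk : k ∈ Ioo (0 : ℝ) 1) :
    frequency L k = freq L (logParam k) := by
  have hek := rootE_mem hk
  have hd : 0 < rootE k * (2 - rootE k) := mul_pos (by linarith [hek.1]) (by linarith [hek.2])
  rw [frequency, freq, quarterPeriod_logParam hk, exp_logParam hk, mul_pow, div_pow,
    Real.sq_sqrt hd.le, show 1 - rootE k * (1 - rootE k) = rootE k ^ 2 - rootE k + 1 by ring,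
    ← rootR_mul_rootE hk]
  have : rootE k ≠ 0 := by linarith [hek.1]
  have : 2 - rootE k ≠ 0 := by linarith [hek.2]
  field_simp

/-- The amplitude of the Jacobi form of the wave is its maximum; both sides have the fourth power
`48 P² / L²`, with `P` the quarter period. -/
theorem paramA_eq {L : ℝ} (hL : 0 < L) (hk : k ∈ Ioo (0 : ℝ) 1) :
    paramA L k = √(4 * √3 * quarterPeriod (logParam k) / L) := by
  have hek := rootE_mem hk
  have hd : 0 < rootE k * (2 - rootE k) := mul_pos (by linarith [hek.1]) (by linarith [hek.2])
  have hsd := Real.sqrt_pos.2 hd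
  have h3 : √3 ^ 2 = (3 : ℝ) := Real.sq_sqrt (by norm_num)
  have hX : 0 ≤ 2 - k ^ 2 + 2 * rootR k := by
    linarith [rootR_nonneg k, (sq_mem_Ioo hk).2]
  have hX3 : (2 - k ^ 2 + 2 * rootR k) * (rootE k * (2 - rootE k)) = 3 := by
    linear_combination 2 * rootR_mul_rootE hk - sq_mul_rootE hk
  have hpos : 0 < 4 * √3 * quarterPeriod (logParam k) / L := by
    have := quarterPeriod_pos (logParam k)
    positivity
  refine (pow_left_inj₀ (by unfold paramA; positivity) (Real.sqrt_nonneg _)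
    (four_ne_zero)).1 ?_
  have h1 : ((2 - k ^ 2 + 2 * rootR k) * L ^ 2 * ellipticK k ^ 2) ^ (1 / 4 : ℝ) =
      ((2 - k ^ 2 + 2 * rootR k) * L ^ 2 * ellipticK k ^ 2) ^ ((4 : ℕ) : ℝ)⁻¹ := by norm_num
  have hK : ellipticK k = quarterPeriod (logParam k) * √(rootE k * (2 - rootE k)) := by
    rw [quarterPeriod_logParam hk]
    field_simp
  rw [paramA, mul_pow, h1, Real.rpow_inv_natCast_pow (by positivity) (by norm_num),
    show ∀ y : ℝ, y ^ 4 = (y ^ 2) ^ 2 from fun y => by ring,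
    show ∀ y : ℝ, √y ^ 4 = (√y ^ 2) ^ 2 from fun y => by ring, Real.sq_sqrt hpos.le, hK, mul_pow,
    Real.sq_sqrt hd.le]
  field_simp
  rw [h3]
  linear_combination 16 * quarterPeriod (logParam k) ^ 2 * hX3

theorem profile_eq_angularWave {L : ℝ} (hL : 0 < L) (κ γ B : ℝ) (hk : k ∈ Ioo (0 : ℝ) 1) :
    profile κ γ B L k =
      angularWave L (1 / (κ + γ * B ^ 3) ^ (1 / 4 : ℝ)) (logParam k) := by
  funext x
  set θ := amplitude k (4 * ellipticK k / L * x) with hθ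
  have h1 : tanScale (tanRatio k) θ = angle (logParam k) (4 / L * x) := by
    apply eq_angle_of_angleTime_eq
    rw [angleTime_tanScale hk, hθ, ellipticF_amplitude hk, quarterPeriod_logParam hk]
    ring
  rw [angularWave, ← h1, cos_tanScale (tanRatio_pos hk), cos_sq_add_tanRatio hk, crest,
    ← paramA_eq hL hk, profile, cn, sn, ← hθ]
  ring

end link

/-! ### Hill operators through Fourier coefficients -/

section hill

variable (L : ℝ) [hL : Fact (0 < L)]

/-- The `n`-th Fourier coefficient as a continuous linear functional. -/
def fourierFunctional (n : ℤ) : L2per L →L[ℂ] ℂ :=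
  (L : ℂ)⁻¹ • innerSL ℂ (ContinuousMap.toLp 2 volume ℂ (fourier n) : L2per L)

theorem fourierFunctional_apply (n : ℤ) (u : L2per L) :
    fourierFunctional L n u = fourierCoeff u n := by
  have h := ContinuousMap.coeFn_toLp (p := 2) (𝕜 := ℂ)
    (volume : Measure (AddCircle L)) (fourier n)
  rw [fourierCoeff, AddCircle.integral_haarAddCircle, fourierFunctional,
    _root_.smul_apply, innerSL_apply_apply, L2.inner_def, Complex.real_smul,
    Complex.ofReal_inv, smul_eq_mul]
  congr 1
  refine integral_congr_ae ?_
  filter_upwards [h] with x hx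
  rw [hx, RCLike.inner_apply, fourier_neg, smul_eq_mul, mul_comm]

/-- Parseval's identity, in `L²_per`. -/
theorem hasSum_inner_fourierCoeff (u v : L2per L) :
    HasSum (fun n => starRingEnd ℂ (fourierCoeff u n) * fourierCoeff v n)
      ((L : ℂ)⁻¹ * inner ℂ u v) := by
  have h := fourierBasis.hasSum_inner_mul_inner ((memLp_haar L u).toLp u)
    ((memLp_haar L v).toLp v)
  have hc : ∀ (w : L2per L) n, inner ℂ (fourierBasis n) ((memLp_haar L w).toLp w) =
      fourierCoeff w n := by
    intro w n
    rw [← HilbertBasis.repr_apply_apply, fourierBasis_repr,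
      fourierCoeff_congr_ae (memLp_haar L w).coeFn_toLp]
  have hin : inner ℂ ((memLp_haar L u).toLp u) ((memLp_haar L v).toLp v) =
      (L : ℂ)⁻¹ * inner ℂ u v := by
    rw [L2.inner_def, L2.inner_def, ← Complex.ofReal_inv, ← Complex.real_smul,
      ← AddCircle.integral_haarAddCircle]
    refine integral_congr_ae ?_
    filter_upwards [(memLp_haar L u).coeFn_toLp, (memLp_haar L v).coeFn_toLp] with x hx hy
    rw [hx, hy]
  rw [← hin]
  refine h.congr_fun fun n => ?_
  rw [← hc u, ← hc v, inner_conj_symm]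

variable (V : C(AddCircle L, ℝ))

theorem hillOperator_apply (u : (hillOperator L V).domain) :
    hillOperator L V u = negSecondDeriv L u + mulOperator L V u := rfl

theorem hillOperator_eq_iff (u : (hillOperator L V).domain) (w : L2per L) :
    hillOperator L V u = w ↔ ∀ n : ℤ,
      (((2 * Real.pi * n / L) ^ 2 : ℝ) : ℂ) * fourierCoeff (u : L2per L) n +
        fourierCoeff (mulOperator L V u) n = fourierCoeff w n := by
  have h : ∀ n : ℤ, fourierCoeff (hillOperator L V u) n =
      (((2 * Real.pi * n / L) ^ 2 : ℝ) : ℂ) * fourierCoeff (u : L2per L) n +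
        fourierCoeff (mulOperator L V u) n := fun n => by
    rw [hillOperator_apply, fourierCoeff_add]
    exact congrArg (· + _) (fourierCoeff_negSecondDeriv L u n)
  refine ⟨fun hw n => by rw [← hw, h], fun hw => eq_of_fourierCoeff_eq L fun n => ?_⟩
  rw [h, hw]

theorem summable_sq_fourierCoeff (u : L2per L) : Summable fun n => ‖fourierCoeff u n‖ ^ 2 := by
  have h := (hasSum_inner_fourierCoeff L u u).summable.norm
  refine h.congr fun n => ?_
  rw [norm_mul, RCLike.norm_conj, sq]

/-- Elliptic regularity: a weak solution in `L²_per` lies in `H²_per`. -/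
theorem mem_domain_of_weak {u w : L2per L}
    (h : ∀ n : ℤ, (((2 * Real.pi * n / L) ^ 2 : ℝ) : ℂ) * fourierCoeff u n +
      fourierCoeff (mulOperator L V u) n = fourierCoeff w n) :
    u ∈ (hillOperator L V).domain := by
  have hL0 := hL.out
  set g := w - mulOperator L V u with hg
  have hgn : ∀ n : ℤ, fourierCoeff g n =
      (((2 * Real.pi * n / L) ^ 2 : ℝ) : ℂ) * fourierCoeff u n := by
    intro n
    have h1 := fourierCoeff_add L g (mulOperator L V u) n
    rw [hg, sub_add_cancel, ← h n] at h1
    rw [hg]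
    exact (add_right_cancel h1).symm
  -- `c` is the inverse of the symbol `(2πn/L)² / n²`
  set c := (L / (2 * Real.pi)) ^ 2 with hc
  refine Summable.of_nonneg_of_le (fun n => by positivity) (fun n => ?_)
    (((summable_sq_fourierCoeff L u).add
      ((summable_sq_fourierCoeff L g).mul_left (c ^ 2))).mul_left 2)
  have h2 : c * ‖fourierCoeff g n‖ = (n : ℝ) ^ 2 * ‖fourierCoeff u n‖ := by
    rw [hgn, norm_mul, Complex.norm_real, Real.norm_eq_abs, abs_of_nonneg (sq_nonneg _), hc]
    have := Real.pi_pos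
    field_simp
  have h3 : ((1 + (n : ℝ) ^ 2) * ‖fourierCoeff u n‖) ^ 2 =
      (‖fourierCoeff u n‖ + c * ‖fourierCoeff g n‖) ^ 2 := by
    rw [h2]
    ring
  calc (1 + (n : ℝ) ^ 2) ^ 2 * ‖fourierCoeff u n‖ ^ 2
      = (‖fourierCoeff u n‖ + c * ‖fourierCoeff g n‖) ^ 2 := by rw [← h3]; ring
    _ ≤ 2 * (‖fourierCoeff u n‖ ^ 2 + c ^ 2 * ‖fourierCoeff g n‖ ^ 2) := by
      nlinarith [sq_nonneg (‖fourierCoeff u n‖ - c * ‖fourierCoeff g n‖)]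

theorem inner_mulOperator_left (u v : L2per L) :
    inner ℂ (mulOperator L V u) v = inner ℂ u (mulOperator L V v) := by
  rw [L2.inner_def, L2.inner_def]
  refine integral_congr_ae ?_
  filter_upwards [coeFn_mulOperator L V u, coeFn_mulOperator L V v] with x hx hy
  rw [hx, hy, RCLike.inner_apply, RCLike.inner_apply, map_mul, Complex.conj_ofReal]
  ring

theorem inner_negSecondDeriv_left (u v : H2per L) :
    inner ℂ (negSecondDeriv L u) (v : L2per L) = inner ℂ (u : L2per L) (negSecondDeriv L v) := by
  have hL0 : (L : ℂ)⁻¹ ≠ 0 := inv_ne_zero (Complex.ofReal_ne_zero.2 hL.out.ne')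
  refine mul_left_cancel₀ hL0 ((hasSum_inner_fourierCoeff L _ _).unique ?_)
  refine (hasSum_inner_fourierCoeff L (u : L2per L) (negSecondDeriv L v)).congr_fun fun n => ?_
  rw [fourierCoeff_negSecondDeriv, fourierCoeff_negSecondDeriv, map_mul, Complex.conj_ofReal]
  ring

theorem inner_hillOperator_left (u v : (hillOperator L V).domain) :
    inner ℂ (hillOperator L V u) (v : L2per L) = inner ℂ (u : L2per L) (hillOperator L V v) := by
  rw [hillOperator_apply, hillOperator_apply, inner_add_left, inner_add_right,
    inner_mulOperator_left]
  congr 1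
  exact inner_negSecondDeriv_left L u v

/-- The kernel of the Hill operator, described by conditions which make sense in `L²_per`. -/
def weakKernel : Submodule ℂ (L2per L) :=
  ⨅ n : ℤ, LinearMap.ker ((((2 * Real.pi * n / L) ^ 2 : ℝ) : ℂ) • fourierFunctional L n +
    (fourierFunctional L n).comp
      (ContinuousLinearMap.holderL volume ⊤ 2 2 (ContinuousLinearMap.mul ℂ ℂ)
        (ContinuousMap.toLp ⊤ volume ℂ (toComplex L V)))).toLinearMap

theorem mem_weakKernel {u : L2per L} : u ∈ weakKernel L V ↔ ∀ n : ℤ,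
    (((2 * Real.pi * n / L) ^ 2 : ℝ) : ℂ) * fourierCoeff u n +
      fourierCoeff (mulOperator L V u) n = 0 := by
  simp only [weakKernel, Submodule.mem_iInf, LinearMap.mem_ker, ← fourierFunctional_apply]
  rfl

theorem isClosed_weakKernel : IsClosed (weakKernel L V : Set (L2per L)) := by
  rw [weakKernel, Submodule.coe_iInf]
  exact isClosed_iInter fun n => ContinuousLinearMap.isClosed_ker _

/-- Since the kernel is closed in `L²_per`, a solution can be made orthogonal to it. -/
theorem existsUnique_orthogonal_solution {w : L2per L} (u₀ : (hillOperator L V).domain)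
    (hu₀ : hillOperator L V u₀ = w) :
    ∃! u : (hillOperator L V).domain,
      (∀ v : (hillOperator L V).domain, hillOperator L V v = 0 →
        inner ℂ (v : L2per L) (u : L2per L) = 0) ∧ hillOperator L V u = w := by
  have hker : ∀ v : (hillOperator L V).domain,
      hillOperator L V v = 0 ↔ (v : L2per L) ∈ weakKernel L V := fun v => by
    rw [hillOperator_eq_iff, mem_weakKernel]
    simp only [fourierCoeff_zero]
  have : CompleteSpace (weakKernel L V) := (isClosed_weakKernel L V).completeSpace_coe
  set p : L2per L := (weakKernel L V).starProjection (u₀ : L2per L) with hp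
  have hpk : p ∈ weakKernel L V := Submodule.starProjection_apply_mem _ _
  have hpd : p ∈ (hillOperator L V).domain := by
    refine mem_domain_of_weak L V (w := 0) fun n => ?_
    rw [(mem_weakKernel L V).1 hpk n, fourierCoeff_zero]
  have hp0 : hillOperator L V ⟨p, hpd⟩ = 0 := (hker _).2 hpk
  refine ⟨u₀ - ⟨p, hpd⟩, ⟨fun v hv => ?_, ?_⟩, ?_⟩
  · exact Submodule.inner_right_of_mem_orthogonal ((hker v).1 hv)
      (Submodule.sub_starProjection_mem_orthogonal (K := weakKernel L V) (u₀ : L2per L))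
  · rw [LinearPMap.map_sub, hp0, hu₀, sub_zero]
  · rintro u ⟨hu, huw⟩
    have hd0 : hillOperator L V (u - (u₀ - ⟨p, hpd⟩)) = 0 := by
      rw [LinearPMap.map_sub, LinearPMap.map_sub, hp0, huw, hu₀, sub_zero, sub_self]
    have h1 := hu _ hd0
    have h2 : inner ℂ ((u - (u₀ - ⟨p, hpd⟩) : (hillOperator L V).domain) : L2per L)
        ((u₀ - ⟨p, hpd⟩ : (hillOperator L V).domain) : L2per L) = 0 :=
      Submodule.inner_right_of_mem_orthogonal ((hker _).1 hd0)
        (Submodule.sub_starProjection_mem_orthogonal (K := weakKernel L V) (u₀ : L2per L))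
    have h3 : inner ℂ ((u - (u₀ - ⟨p, hpd⟩) : (hillOperator L V).domain) : L2per L)
        ((u - (u₀ - ⟨p, hpd⟩) : (hillOperator L V).domain) : L2per L) = 0 := by
      nth_rw 2 [Submodule.coe_sub]
      rw [inner_sub_right, h1, h2, sub_zero]
    have h4 := inner_self_eq_zero.1 h3
    exact sub_eq_zero.1 (Subtype.ext h4)

/-- By symmetry, the pairing of a solution with the right-hand side does not depend on the
solution. -/
theorem inner_solution_eq {w : L2per L} {u v : (hillOperator L V).domain}
    (hu : hillOperator L V u = w) (hv : hillOperator L V v = w) :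
    inner ℂ w (u : L2per L) = inner ℂ (v : L2per L) w := by
  conv_lhs => rw [← hv]
  rw [inner_hillOperator_left, hu]

/-! ### Real continuous functions on the circle -/

theorem coeFn_toLp_toComplex (f : C(AddCircle L, ℝ)) :
    (ContinuousMap.toLp 2 volume ℂ (toComplex L f) : L2per L) =ᵐ[volume] fun x => (f x : ℂ) :=
  ContinuousMap.coeFn_toLp (p := 2) (𝕜 := ℂ) volume (toComplex L f)

theorem fourierCoeff_toLp_toComplex (f : C(AddCircle L, ℝ)) (n : ℤ) :
    fourierCoeff (ContinuousMap.toLp 2 volume ℂ (toComplex L f) : L2per L) n =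
      (L : ℂ)⁻¹ *
        ∫ x in (0 : ℝ)..L, fourier (-n) (x : AddCircle L) * (f (x : AddCircle L) : ℂ) := by
  rw [fourierCoeff_congr_ae (ae_haar_of_ae L (coeFn_toLp_toComplex L f)),
    fourierCoeff_eq_intervalIntegral _ n 0, zero_add, Complex.real_smul]
  simp

theorem mulOperator_toLp_toComplex (f : C(AddCircle L, ℝ)) :
    mulOperator L V (ContinuousMap.toLp 2 volume ℂ (toComplex L f)) =
      ContinuousMap.toLp 2 volume ℂ (toComplex L (V * f)) := by
  apply Lp.ext
  filter_upwards [coeFn_mulOperator L V (ContinuousMap.toLp 2 volume ℂ (toComplex L f)),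
    coeFn_toLp_toComplex L f, coeFn_toLp_toComplex L (V * f)] with x h1 h2 h3
  rw [h1, h2, h3]
  simp

theorem inner_toLp_toComplex (f g : C(AddCircle L, ℝ)) :
    inner ℂ (ContinuousMap.toLp 2 volume ℂ (toComplex L f) : L2per L)
      (ContinuousMap.toLp 2 volume ℂ (toComplex L g)) =
      ((∫ x in (0 : ℝ)..L, f (x : AddCircle L) * g (x : AddCircle L) : ℝ) : ℂ) := by
  have h := AddCircle.intervalIntegral_preimage L 0 (fun x => f x * g x)
  rw [zero_add] at h
  rw [h, L2.inner_def, ← integral_complex_ofReal]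
  refine integral_congr_ae ?_
  filter_upwards [coeFn_toLp_toComplex L f, coeFn_toLp_toComplex L g] with x h1 h2
  rw [h1, h2, RCLike.inner_apply, Complex.conj_ofReal]
  push_cast
  ring

theorem norm_sq_toLp_toComplex (f : C(AddCircle L, ℝ)) :
    ‖(ContinuousMap.toLp 2 volume ℂ (toComplex L f) : L2per L)‖ ^ 2 =
      ∫ x in (0 : ℝ)..L, f (x : AddCircle L) ^ 2 := by
  rw [← inner_self_eq_norm_sq (𝕜 := ℂ), inner_toLp_toComplex]
  simp [sq]

end hill

/-! ### The waves and their parameter derivatives on the circle -/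

theorem continuous_fourier_coe (L : ℝ) (n : ℤ) :
    Continuous fun x : ℝ => (fourier n (x : AddCircle L) : ℂ) :=
  (map_continuous (fourier n)).comp (AddCircle.continuous_mk' L)

/-- Integration by parts of a periodic function against an exponential. -/
theorem integral_fourier_mul_deriv (L : ℝ) {f f' : ℝ → ℝ} (hf : ∀ x, HasDerivAt f (f' x) x)
    (hf' : Continuous f') (hper : f L = f 0) (n : ℤ) :
    ∫ x in (0 : ℝ)..L, fourier (-n) (x : AddCircle L) * (f' x : ℂ) =
      2 * Real.pi * Complex.I * n / L *
        ∫ x in (0 : ℝ)..L, fourier (-n) (x : AddCircle L) * (f x : ℂ) := by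
  have hcont : Continuous f := continuous_iff_continuousAt.2 fun x => (hf x).continuousAt
  have hc := continuous_fourier_coe L (-n)
  have h := intervalIntegral.integral_mul_deriv_eq_deriv_mul (a := 0) (b := L)
    (u := fun x : ℝ => (fourier (-n) (x : AddCircle L) : ℂ)) (v := fun x => (f x : ℂ))
    (u' := fun x => -2 * Real.pi * Complex.I * n / L * fourier (-n) (x : AddCircle L))
    (v' := fun x => (f' x : ℂ))
    (fun x _ => hasDerivAt_fourier_neg L n x) (fun x _ => (hf x).ofReal_comp)
    ((continuous_const.mul hc).intervalIntegrable _ _)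
    ((Complex.continuous_ofReal.comp hf').intervalIntegrable _ _)
  rw [h, hper, AddCircle.coe_period, QuotientAddGroup.mk_zero, sub_self, zero_sub,
    ← intervalIntegral.integral_neg, ← intervalIntegral.integral_const_mul]
  refine intervalIntegral.integral_congr fun x _ => ?_
  ring

section circle

variable (L : ℝ) [hL : Fact (0 < L)]

/-- The wave of parameter `exp σ`, on the circle. -/
def circleWave (C σ : ℝ) : C(AddCircle L, ℝ) where
  toFun := (periodic_angularWave hL.out C σ).lift
  continuous_toFun :=
    continuous_coinduced_dom.2 ((continuous_angularWave hL.out C).uncurry_left σ)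

/-- The `σ`-derivative of the wave, on the circle. -/
def circleWaveDeriv (C σ : ℝ) : C(AddCircle L, ℝ) where
  toFun := (periodic_angularWaveDeriv hL.out C σ).lift
  continuous_toFun :=
    continuous_coinduced_dom.2 ((continuous_angularWaveDeriv hL.out C).uncurry_left σ)

theorem circleWave_coe (C σ x : ℝ) : circleWave L C σ (x : AddCircle L) = angularWave L C σ x := rfl

theorem circleWaveDeriv_coe (C σ x : ℝ) :
    circleWaveDeriv L C σ (x : AddCircle L) = angularWaveDeriv L C σ x := rfl

/-- The profile equation tested against the exponentials. -/
theorem integral_fourier_mul_profile_eq_zero {C β : ℝ} (hβ : β * C ^ 4 = 1) (σ : ℝ) (n : ℤ) :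
    ∫ x in (0 : ℝ)..L, fourier (-n) (x : AddCircle L) *
      ((((2 * Real.pi * n / L) ^ 2 + freq L σ) * angularWave L C σ x -
        β * angularWave L C σ x ^ 5 : ℝ) : ℂ) = 0 := by
  have hL0 := hL.out
  have hw : Continuous (angularWave L C σ) := (continuous_angularWave hL0 C).uncurry_left σ
  have hs : Continuous (angularWaveSlope L C σ) := continuous_iff_continuousAt.2 fun x =>
    (hasDerivAt_angularWaveSlope hL0 hβ σ x).continuousAt
  have hc := continuous_fourier_coe L (-n)
  have h1 := integral_fourier_mul_deriv L (hasDerivAt_angularWave_right L C σ) hs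
    (by simpa using periodic_angularWave hL0 C σ 0) n
  have h2 := integral_fourier_mul_deriv L (hasDerivAt_angularWaveSlope hL0 hβ σ) (by fun_prop)
    (by simpa using periodic_angularWaveSlope hL0 C σ 0) n
  rw [h1, ← mul_assoc, ← sub_eq_zero, ← intervalIntegral.integral_const_mul,
    ← intervalIntegral.integral_sub] at h2
  · rw [← h2]
    refine intervalIntegral.integral_congr fun x _ => ?_
    push_cast
    linear_combination (fourier (-n) (x : AddCircle L) * (angularWave L C σ x : ℂ) *
      (2 * Real.pi * n / L) ^ 2) * Complex.I_sq
  · exact (hc.mul (Complex.continuous_ofReal.comp (by fun_prop))).intervalIntegrable _ _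
  · exact (continuous_const.mul (hc.mul (Complex.continuous_ofReal.comp hw))).intervalIntegrable _ _

/-- The `σ`-derivative of the profile equation: the linearized equation `ℒ₁ ∂φ = -ω' φ`, tested
against the exponentials. -/
theorem integral_fourier_mul_linearized_eq_zero {C β : ℝ} (hβ : β * C ^ 4 = 1) (σ : ℝ) (n : ℤ) :
    ∫ x in (0 : ℝ)..L, fourier (-n) (x : AddCircle L) *
      ((freqDeriv L σ * angularWave L C σ x +
        ((2 * Real.pi * n / L) ^ 2 + freq L σ - 5 * β * angularWave L C σ x ^ 4) *
          angularWaveDeriv L C σ x : ℝ) : ℂ) = 0 := by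
  have hL0 := hL.out
  have hc : Continuous fun p : ℝ × ℝ => (fourier (-n) (p.2 : AddCircle L) : ℂ) :=
    (continuous_fourier_coe L (-n)).comp continuous_snd
  have hw : Continuous fun p : ℝ × ℝ => angularWave L C p.1 p.2 := continuous_angularWave hL0 C
  have hv : Continuous fun p : ℝ × ℝ => angularWaveDeriv L C p.1 p.2 :=
    continuous_angularWaveDeriv hL0 C
  have hΩ : Continuous fun p : ℝ × ℝ => freq L p.1 := (continuous_freq L).comp continuous_fst
  have hΩ' : Continuous fun p : ℝ × ℝ => freqDeriv L p.1 :=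
    (continuous_freqDeriv L).comp continuous_fst
  have h1 : Continuous fun p : ℝ × ℝ => fourier (-n) (p.2 : AddCircle L) *
      ((((2 * Real.pi * n / L) ^ 2 + freq L p.1) * angularWave L C p.1 p.2 -
        β * angularWave L C p.1 p.2 ^ 5 : ℝ) : ℂ) :=
    hc.mul (Complex.continuous_ofReal.comp (by fun_prop))
  have h2 : Continuous fun p : ℝ × ℝ => fourier (-n) (p.2 : AddCircle L) *
      ((freqDeriv L p.1 * angularWave L C p.1 p.2 +
        ((2 * Real.pi * n / L) ^ 2 + freq L p.1 - 5 * β * angularWave L C p.1 p.2 ^ 4) *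
          angularWaveDeriv L C p.1 p.2 : ℝ) : ℂ) :=
    hc.mul (Complex.continuous_ofReal.comp (by fun_prop))
  have h := hasDerivAt_intervalIntegral_of_continuous
    (F := fun s x => fourier (-n) (x : AddCircle L) *
      ((((2 * Real.pi * n / L) ^ 2 + freq L s) * angularWave L C s x -
        β * angularWave L C s x ^ 5 : ℝ) : ℂ))
    (F' := fun s x => fourier (-n) (x : AddCircle L) *
      ((freqDeriv L s * angularWave L C s x +
        ((2 * Real.pi * n / L) ^ 2 + freq L s - 5 * β * angularWave L C s x ^ 4) *
          angularWaveDeriv L C s x : ℝ) : ℂ)) h1 h2 (fun s x => ?_) 0 L σ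
  · simp only [integral_fourier_mul_profile_eq_zero L hβ] at h
    exact h.unique (hasDerivAt_const σ 0)
  · have hws := hasDerivAt_angularWave_left hL0 C s x
    have h3 := (((hasDerivAt_freq L s).const_add ((2 * Real.pi * n / L) ^ 2)).fun_mul hws).fun_sub
      ((hws.fun_pow 5).const_mul β)
    refine HasDerivAt.const_mul _ (HasDerivAt.ofReal_comp ?_)
    convert! h3 using 1
    push_cast
    ring

/-- The potential of the linearized operator, in the parametrization by `σ`. -/
def linearizedPotential (C β σ : ℝ) : C(AddCircle L, ℝ) :=
  ContinuousMap.const _ (freq L σ) - (5 * β) • circleWave L C σ ^ 4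

/-- A solution of `ℒ₁ u = φ`, namely `u = -∂φ / ω'`, where the derivatives are taken in `σ`. -/
def linearizedSolution (C σ : ℝ) : L2per L :=
  ContinuousMap.toLp 2 volume ℂ (toComplex L (-(1 / freqDeriv L σ) • circleWaveDeriv L C σ))

theorem linearizedSolution_weak {C β : ℝ} (hβ : β * C ^ 4 = 1) {σ : ℝ} (hσ : freqDeriv L σ ≠ 0)
    (n : ℤ) :
    (((2 * Real.pi * n / L) ^ 2 : ℝ) : ℂ) * fourierCoeff (linearizedSolution L C σ) n +
      fourierCoeff (mulOperator L (linearizedPotential L C β σ) (linearizedSolution L C σ)) n =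
    fourierCoeff (ContinuousMap.toLp 2 volume ℂ (toComplex L (circleWave L C σ)) : L2per L) n := by
  have hcont : ∀ f : C(AddCircle L, ℝ), IntervalIntegrable
      (fun x : ℝ => fourier (-n) (x : AddCircle L) * (f (x : AddCircle L) : ℂ)) volume 0 L := by
    intro f
    refine Continuous.intervalIntegrable ((continuous_fourier_coe L (-n)).mul
      (Complex.continuous_ofReal.comp (f.continuous.comp (AddCircle.continuous_mk' L)))) _ _
  rw [linearizedSolution, mulOperator_toLp_toComplex, fourierCoeff_toLp_toComplex,
    fourierCoeff_toLp_toComplex, fourierCoeff_toLp_toComplex]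
  rw [mul_left_comm, ← mul_add]
  congr 1
  rw [← intervalIntegral.integral_const_mul,
    ← intervalIntegral.integral_add ((hcont _).const_mul _) (hcont _), ← sub_eq_zero,
    ← intervalIntegral.integral_sub (((hcont _).const_mul _).add (hcont _)) (hcont _)]
  have h := congrArg (fun z : ℂ => -(1 / (freqDeriv L σ : ℂ)) * z)
    (integral_fourier_mul_linearized_eq_zero L hβ σ n)
  simp only [mul_zero] at h
  rw [← intervalIntegral.integral_const_mul] at h
  rw [← h]
  refine intervalIntegral.integral_congr fun x _ => ?_
  have hσ' : (freqDeriv L σ : ℂ) ≠ 0 := Complex.ofReal_ne_zero.2 hσ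
  simp only [ContinuousMap.smul_apply, ContinuousMap.mul_apply, linearizedPotential,
    ContinuousMap.sub_apply, ContinuousMap.const_apply, ContinuousMap.pow_apply, circleWave_coe,
    circleWaveDeriv_coe, smul_eq_mul]
  push_cast
  field_simp
  ring

theorem norm_sq_circleWave (C σ : ℝ) :
    ‖(ContinuousMap.toLp 2 volume ℂ (toComplex L (circleWave L C σ)) : L2per L)‖ ^ 2 =
      C ^ 2 * √3 * massIntegral σ := by
  rw [norm_sq_toLp_toComplex, ← integral_angularWave_sq hL.out]
  rfl

/-- The pairing `(ℒ₁⁻¹ φ, φ)` is a quotient of the derivatives of mass and frequency. -/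
theorem inner_linearizedSolution {C σ m : ℝ} (hm : HasDerivAt massIntegral m σ) :
    inner ℂ (linearizedSolution L C σ)
      (ContinuousMap.toLp 2 volume ℂ (toComplex L (circleWave L C σ)) : L2per L) =
    ((-(C ^ 2 * √3 * m) / (2 * freqDeriv L σ) : ℝ) : ℂ) := by
  have hL0 := hL.out
  have hw : Continuous fun p : ℝ × ℝ => angularWave L C p.1 p.2 := continuous_angularWave hL0 C
  have hv : Continuous fun p : ℝ × ℝ => angularWaveDeriv L C p.1 p.2 :=
    continuous_angularWaveDeriv hL0 C
  have h1 : Continuous fun p : ℝ × ℝ => angularWave L C p.1 p.2 ^ 2 := by fun_prop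
  have h2 : Continuous fun p : ℝ × ℝ =>
      2 * (angularWaveDeriv L C p.1 p.2 * angularWave L C p.1 p.2) := by fun_prop
  have h := hasDerivAt_intervalIntegral_of_continuous
    (F := fun s x => angularWave L C s x ^ 2)
    (F' := fun s x => 2 * (angularWaveDeriv L C s x * angularWave L C s x)) h1 h2 (fun s x => by
    have := (hasDerivAt_angularWave_left hL0 C s x).fun_pow 2
    convert! this using 1
    push_cast
    ring) 0 L σ
  simp only [integral_angularWave_sq hL0] at h
  have h3 := h.unique (hm.const_mul (C ^ 2 * √3))
  rw [intervalIntegral.integral_const_mul] at h3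
  rw [linearizedSolution, inner_toLp_toComplex, ← h3]
  congr 1
  simp only [ContinuousMap.smul_apply, smul_eq_mul, circleWave_coe, circleWaveDeriv_coe, mul_assoc]
  rw [intervalIntegral.integral_const_mul, neg_div, mul_div_mul_left _ _ two_ne_zero]
  ring

end circle

/-! ### The parameter as a function of the frequency -/

/-- The parameter `σ` of the wave of frequency `ω`. -/
def freqParam (L ω : ℝ) : ℝ := logParam (modulus L ω)

theorem freqParam_neg (L ω : ℝ) : freqParam L ω < 0 := logParam_neg (modulus L ω).2

section freqParam

variable {L : ℝ} [hL : Fact (0 < L)]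

theorem exists_frequency_eq {ω : ℝ} (hω : 4 * Real.pi ^ 2 / L ^ 2 < ω) :
    ∃ k ∈ Ioo (0 : ℝ) 1, frequency L k = ω := by
  obtain ⟨σ, hσ, hσω⟩ := exists_freq_eq hL.out hω
  obtain ⟨k, hk, rfl⟩ := exists_logParam_eq hσ
  exact ⟨k, hk, (frequency_eq_freq L hk).trans hσω⟩

theorem frequency_injOn : InjOn (frequency L) (Ioo 0 1) := by
  intro k hk l hl h
  rw [frequency_eq_freq L hk, frequency_eq_freq L hl] at h
  exact logParam_injOn hk hl
    ((strictAntiOn_freq hL.out).injOn (logParam_neg hk) (logParam_neg hl) h)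

theorem frequency_modulus {ω : ℝ} (hω : 4 * Real.pi ^ 2 / L ^ 2 < ω) :
    frequency L (modulus L ω) = ω := by
  obtain ⟨k, hk, hkω⟩ := exists_frequency_eq hω
  exact Function.invFun_eq (f := fun k : Ioo (0 : ℝ) 1 => frequency L k) ⟨⟨k, hk⟩, hkω⟩

theorem freq_freqParam {ω : ℝ} (hω : 4 * Real.pi ^ 2 / L ^ 2 < ω) :
    freq L (freqParam L ω) = ω := by
  rw [freqParam, ← frequency_eq_freq L (modulus L ω).2, frequency_modulus hω]

theorem freqDeriv_freqParam_neg (ω : ℝ) : freqDeriv L (freqParam L ω) < 0 :=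
  freqDeriv_neg hL.out (Real.exp_lt_one_iff.2 (freqParam_neg L ω))

/-- The inverse function theorem for `freq`; near `ω`, the function `freqParam` is its local inverse
because `freq` is injective on the negative half-line. -/
theorem hasDerivAt_freqParam {ω : ℝ} (hω : 4 * Real.pi ^ 2 / L ^ 2 < ω) :
    HasDerivAt (freqParam L) (freqDeriv L (freqParam L ω))⁻¹ ω := by
  set σ := freqParam L ω with hσ
  have hσω : freq L σ = ω := freq_freqParam hω
  have hne := (freqDeriv_freqParam_neg (L := L) ω).ne
  rw [← hσ] at hne
  have hs : HasStrictDerivAt (freq L) (freqDeriv L σ) σ :=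
    hasStrictDerivAt_of_hasDerivAt_of_continuousAt
      (Eventually.of_forall fun s => hasDerivAt_freq L s) (continuous_freqDeriv L).continuousAt
  have hg := hs.to_localInverse hne
  have hright := (hs.hasStrictFDerivAt_equiv hne).eventually_right_inverse
  have hgσ := (hs.hasStrictFDerivAt_equiv hne).localInverse_apply_image
  rw [hσω] at hg hright hgσ
  refine hg.hasDerivAt.congr_of_eventuallyEq ?_
  have hgc := hg.hasDerivAt.continuousAt
  have hneg : ∀ᶠ w in 𝓝 ω, hs.localInverse (freq L) (freqDeriv L σ) σ hne w < 0 := by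
    refine hgc.eventually_lt continuousAt_const ?_
    exact hgσ.trans_lt (freqParam_neg L ω)
  filter_upwards [hright, hneg, lt_mem_nhds hω] with w h1 h2 h3
  exact (strictAntiOn_freq hL.out).injOn (freqParam_neg L w) h2 ((freq_freqParam h3).trans h1.symm)

end freqParam

/-- The constant in front of the wave profile. -/
def coupling (κ γ B : ℝ) : ℝ := 1 / (κ + γ * B ^ 3) ^ (1 / 4 : ℝ)

theorem coupling_pow {κ γ B : ℝ} (hpos : 0 < κ + γ * B ^ 3) :
    (κ + γ * B ^ 3) * coupling κ γ B ^ 4 = 1 := by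
  have h1 : (κ + γ * B ^ 3) ^ (1 / 4 : ℝ) = (κ + γ * B ^ 3) ^ ((4 : ℕ) : ℝ)⁻¹ := by norm_num
  rw [coupling, div_pow, h1, Real.rpow_inv_natCast_pow hpos.le (by norm_num), one_pow,
    mul_one_div_cancel hpos.ne']

theorem wave_eq_circleWave (L : ℝ) [hL : Fact (0 < L)] (κ γ B ω : ℝ) :
    wave L κ γ B ω = circleWave L (coupling κ γ B) (freqParam L ω) := by
  ext x
  induction x using QuotientAddGroup.induction_on with
  | H x =>
    exact congrFun (profile_eq_angularWave hL.out κ γ B (modulus L ω).2) x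

theorem norm_sq_waveL2 (L : ℝ) [hL : Fact (0 < L)] (κ γ B ω : ℝ) :
    ‖waveL2 L κ γ B ω‖ ^ 2 =
      coupling κ γ B ^ 2 * √3 * massIntegral (freqParam L ω) := by
  rw [waveL2, wave_eq_circleWave, norm_sq_circleWave]

end

end CnoidalWave

theorem mainTheorem4 (L : ℝ) [hL : Fact (0 < L)] (κ γ B : ℝ) (hκ : 0 < κ) (hγ : 0 ≤ γ)
    (hB : κ + γ * B ^ 3 = κ * B ^ 4 + γ * B) (hpos : 0 < κ + γ * B ^ 3)
    (ω : ℝ) (hω : 4 * Real.pi ^ 2 / L ^ 2 < ω) :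
    (∃! k : ℝ, k ∈ Set.Ioo (0 : ℝ) 1 ∧ CnoidalWave.frequency L k = ω) ∧
    (DifferentiableAt ℝ (fun w : ℝ => ‖CnoidalWave.waveL2 L κ γ B w‖ ^ 2) ω ∧
      0 < deriv (fun w : ℝ => ‖CnoidalWave.waveL2 L κ γ B w‖ ^ 2) ω) ∧
    (∃! u : (CnoidalWave.operatorL1 L κ γ B ω).domain,
      (∀ v : (CnoidalWave.operatorL1 L κ γ B ω).domain,
        CnoidalWave.operatorL1 L κ γ B ω v = 0 →
          inner ℂ (v : CnoidalWave.L2per L) (u : CnoidalWave.L2per L) = 0) ∧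
      CnoidalWave.operatorL1 L κ γ B ω u = CnoidalWave.waveL2 L κ γ B ω) ∧
    (∀ u : (CnoidalWave.operatorL1 L κ γ B ω).domain,
      CnoidalWave.operatorL1 L κ γ B ω u = CnoidalWave.waveL2 L κ γ B ω →
        (inner ℂ (CnoidalWave.waveL2 L κ γ B ω) (u : CnoidalWave.L2per L)).im = 0 ∧
        (inner ℂ (CnoidalWave.waveL2 L κ γ B ω) (u : CnoidalWave.L2per L)).re < 0) := by
  open CnoidalWave in
  have hC := coupling_pow hpos
  have hC2 : 0 < coupling κ γ B ^ 2 * √3 := by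
    have : coupling κ γ B ≠ 0 := by
      rintro h
      simp [h] at hC
    positivity
  obtain ⟨m, hm, hmass⟩ := exists_hasDerivAt_massIntegral_neg (freqParam L ω)
  have hΩ := freqDeriv_freqParam_neg (L := L) ω
  have hV : ContinuousMap.const _ ω - beta1 κ γ B • wave L κ γ B ω ^ 4 =
      linearizedPotential L (coupling κ γ B) (κ + γ * B ^ 3) (freqParam L ω) := by
    rw [linearizedPotential, freq_freqParam hω, wave_eq_circleWave, beta1]
  have hw : waveL2 L κ γ B ω = ContinuousMap.toLp 2 volume ℂ
      (toComplex L (circleWave L (coupling κ γ B) (freqParam L ω))) := by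
    rw [waveL2, wave_eq_circleWave]
  have hweak := linearizedSolution_weak L hC hΩ.ne
  have hderiv : HasDerivAt (fun w : ℝ => ‖waveL2 L κ γ B w‖ ^ 2)
      (coupling κ γ B ^ 2 * √3 * (m * (freqDeriv L (freqParam L ω))⁻¹)) ω := by
    simp only [norm_sq_waveL2]
    exact (hmass.comp ω (hasDerivAt_freqParam hω)).const_mul _
  have hsol := (hillOperator_eq_iff L _
    ⟨linearizedSolution L (coupling κ γ B) (freqParam L ω), mem_domain_of_weak L _ hweak⟩ _).2 hweak
  refine ⟨?_, ⟨hderiv.differentiableAt, ?_⟩, ?_, ?_⟩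
  · obtain ⟨k, hk, hkω⟩ := exists_frequency_eq hω
    exact ⟨k, ⟨hk, hkω⟩, fun l hl => frequency_injOn hl.1 hk (hl.2.trans hkω.symm)⟩
  · rw [hderiv.deriv]
    exact mul_pos hC2 (mul_pos_of_neg_of_neg hm (inv_lt_zero.2 hΩ))
  · rw [operatorL1, hV, hw]
    exact existsUnique_orthogonal_solution L _ _ hsol
  · rw [operatorL1, hV, hw]
    intro u hu
    have h := (inner_solution_eq L _ hu hsol).trans (inner_linearizedSolution L hmass)
    rw [h, Complex.ofReal_im, Complex.ofReal_re]
    refine ⟨rfl, div_neg_of_pos_of_neg ?_ (by linarith)⟩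
    nlinarith
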